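/- Let $\mathbf k$ be an algebraically closed field of characteristic different from $2$ and $3$. Consider the following five-dimensional commutative algebras over $\mathbf k$ with basis $n_1,\dots,n_5$; products of basis elements that are not listed are $0$ or are determined by commutativity. **List 1.** $\epsilon_1$: $n_1^2=n_2,\ n_2^2=n_1n_3=n_4,\ n_1n_2=n_3,\ n_1n_4=n_2n_3=n_5$; $\epsilon_2$: $n_1^2=n_2,\ n_2^2=n_1n_3=n_5^2=n_4,\ n_1n_2=n_3$; $\epsilon_3$: $n_1^2=n_2,\ n_4^2=n_5,\ n_1n_2=n_4n_5=n_3$; $\epsilon_4$: $n_1^2=n_3,\ n_1n_2=n_4,\ n_1n_4=n_2n_3=n_5$; $\epsilon_5$: $n_1^2=n_2,\ n_2^2=n_1n_3=n_4,\ n_1n_2=n_3$; $\epsilon_6$: $n_1^2=n_2,\ n_1n_2=n_3,\ n_4^2=n_5$; $\epsilon_7$: $n_1n_3=n_4,\ n_2n_3=n_5,\ n_1n_2=n_4-n_5$; $\epsilon_8$: $n_1^2=n_3,\ n_2^2=n_1n_3=n_4,\ n_1n_2=n_5$; $\epsilon_9$: $n_1n_3=n_5,\ n_1n_2=n_4,\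 n_2n_3=-n_5$; $\epsilon_{10}$: $n_1^2=n_3,\ n_1n_3=n_4,\ n_1n_2=n_5$; $\epsilon_{11}$: $n_1^2=n_2n_3=n_4,\ n_1n_3=n_5$; $\epsilon_{12}$: $n_1n_2=n_4,\ n_1n_3=n_5$; $\epsilon_{13}$: $n_3^2=n_4,\ n_1n_2=n_3n_4=n_5$; $\epsilon_{14}$: $n_1^2=n_2,\ n_4^2=n_1n_2=n_3$; $\epsilon_{15}$: $n_1^2=n_2^2=n_3,\ n_4^2=n_5$; $\epsilon_{16}$: $n_1^2=n_3,\ n_2^2=n_5,\ n_1n_2=n_4$; $\epsilon_{17}$: $n_1^2=n_4,\ n_3^2=n_1n_2=n_5$; $\epsilon_{18}$: $n_1^2=n_2,\ n_1n_2=n_3$; $\epsilon_{19}$: $n_1^2=n_2,\ n_3^2=n_4$; $\epsilon_{20}$: $n_1^2=n_2,\ n_1n_3=n_4$; $\epsilon_{21}$: $n_2n_3=n_1n_4=n_5$; $\epsilon_{22}$: $n_1^2=n_3n_4=n_2$; $\epsilon_{23}$: $n_1^2=n_2^2=n_3$; $\epsilon_{24}$: $n_1^2=n_2$; $\epsilon_{25}$: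 all products $0$. **List 2** (all parameters range over $\mathbf k$). $\mathcal J_1$: $n_1^2=n_2,\ n_1n_2=n_2n_4=n_3$; $\mathcal J_2$: $n_1^2=n_2,\ n_4^2=-n_2,\ n_1n_2=n_2n_4=n_3$; $\mathcal J_3$: $n_1^2=n_2,\ n_4^2=-n_2-n_3,\ n_1n_2=n_2n_4=n_3$; $\mathcal J_4$: $n_1^2=n_4^2=n_2,\ n_1n_2=n_3$; $\mathcal J_5$: $n_1^2=n_2,\ n_4^2=n_2n_3=n_5$; $\mathcal J_6$: $n_1^2=n_2,\ n_1n_4=n_2n_3=n_5$; $\mathcal J_7$: $n_1n_2=n_3,\ n_3n_4=n_5$; $\mathcal J_8$: $n_1n_2=n_3,\ n_3n_4=n_1^2=n_5$; $\mathcal J_9$: $n_1n_2=n_3,\ n_3n_4=n_1^2=n_2^2=n_5$; $\mathcal J_{10}$: $n_1n_2=n_3,\ n_1n_3=n_4^2=n_2n_3=n_5$; $\mathcal J_{11}$: $n_1n_2=n_3,\ n_1n_3=n_4^2=n_5$; $\mathcal J_{12}$: $n_1n_2=n_3,\ n_1n_3=n_4^2=n_2^2=n_5$; $\mathcal J_{13}$: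 $n_1n_2=n_3,\ n_1n_4=n_1n_3=n_2n_3=n_5$; $\mathcal J_{14}$: $n_1n_2=n_3,\ n_1n_3=n_2n_4=n_5$; $\mathcal J_{15}^{\alpha}$: $n_1^2=n_2,\ n_1n_2=n_3,\ n_4^2=\alpha n_5,\ n_2^2=n_1n_3=n_2n_4=n_5$; $\mathcal J_{16}$: $n_1n_2=n_3^2=n_4,\ n_1n_4=n_5$; $\mathcal J_{17}$: $n_1n_2=n_3^2=n_4,\ n_1n_4=n_2n_3=n_5$; $\mathcal J_{18}$: $n_1n_2=n_3^2=n_4,\ n_1n_4=n_2^2=n_5$; $\mathcal J_{19}$: $n_1n_2=n_3^2=n_4,\ n_3n_4=n_5$; $\mathcal J_{20}$: $n_1n_2=n_3^2=n_4,\ n_3n_4=n_1^2=n_5$; $\mathcal J_{21}$: $n_1n_2=n_3^2=n_4,\ n_3n_4=n_1^2=n_2^2=n_5$; $\mathcal J_{22}$: $n_1^2=n_2,\ n_1n_2=n_3^2=n_4,\ n_2^2=n_1n_4=n_5$; $\mathcal J_{23}^{\beta}$: $n_1^2=n_3,\ n_1n_2=n_4,\ n_1n_3=n_2n_4=n_5,\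 n_2n_3=\beta n_5$; $\mathcal J_{24}^{\gamma}$: $n_1^2=n_3,\ n_1n_2=n_4,\ n_2n_3=n_5,\ n_1n_4=\gamma n_5$; $\mathcal J_{25}$: $n_1^2=n_3,\ n_1n_2=n_4,\ n_1n_3=n_1n_4=n_5,\ n_2n_3=-2n_5$; $\mathcal J_{26}^{\delta}$: $n_1^2=n_3,\ n_2^2=n_4,\ n_1n_3=n_1n_4=n_5,\ n_2n_4=\delta n_5$; $\mathcal J_{27}^{\varepsilon,\phi}$: $n_1^2=n_3,\ n_2^2=n_4,\ n_2n_3=n_1n_4=n_5,\ n_2n_4=\varepsilon n_5,\ n_1n_3=\phi n_5$; $\mathcal J_{28}$: $n_1^2=n_2,\ n_2n_3=n_4,\ n_3^2=n_5$; $\mathcal J_{29}$: $n_1^2=n_2,\ n_2n_3=n_4,\ n_1n_3=n_5$; $\mathcal J_{30}$: $n_1^2=n_2,\ n_2n_3=n_4,\ n_1n_3=n_3^2=n_5$; $\mathcal J_{31}$: $n_1^2=n_2,\ n_2n_3=n_4,\ n_1n_2=n_5$; $\mathcal J_{32}$: $n_1^2=n_2,\ n_2n_3=n_4,\ n_1n_2=n_1n_3=n_5$;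 $\mathcal J_{33}$: $n_1^2=n_2,\ n_2n_3=n_4,\ n_1n_2=n_3^2=n_5$; $\mathcal J_{34}$: $n_1n_2=n_3,\ n_1n_3=n_4,\ n_1^2=n_5$; $\mathcal J_{35}$: $n_1n_2=n_3,\ n_1n_3=n_4,\ n_2^2=n_5$; $\mathcal J_{36}$: $n_1n_2=n_3,\ n_1n_3=n_4,\ n_2n_3=n_5$; $\mathcal J_{37}$: $n_1^2=n_2^2=n_5,\ n_1n_2=n_3,\ n_1n_3=n_4$; $\mathcal J_{38}$: $n_1n_2=n_3,\ n_1n_3=n_4,\ n_1^2=n_2n_3=n_5$; $\mathcal J_{39}$: $n_1n_2=n_3,\ n_1^2=n_5,\ n_2^2=n_1n_3=n_4$; $\mathcal J_{40}$: $n_1n_2=n_3,\ n_2^2=n_1n_3=n_4,\ n_1^2=n_2n_3=n_5$; $\mathcal J_{41}^{\lambda}$: $n_1^2=n_5,\ n_1n_2=n_3,\ n_2^2=\lambda n_5,\ n_1n_3=n_2n_3=n_4$. **Theorem.** All these algebras are nilpotent Jordan algebras. Those of List 1 are associative; those of List 2 are not associative, with the single exception of $\mathcal J_{24}^1$. The algebras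 of the two lists are pairwise non-isomorphic, except for exactly the following isomorphisms (and their inverses): 1. $\mathcal J_{15}^{\alpha_1}\simeq\mathcal J_{15}^{\alpha_2}$ if and only if $\alpha_1=\alpha_2$, and $\mathcal J_{24}^{\alpha_1}\simeq\mathcal J_{24}^{\alpha_2}$ if and only if $\alpha_1=\alpha_2$; 2. $\mathcal J_{23}^{\beta_1}\simeq\mathcal J_{23}^{\beta_2}$ if and only if $\beta_1=\pm\beta_2$, and $\mathcal J_{26}^{\beta_1}\simeq\mathcal J_{26}^{\beta_2}$ if and only if $\beta_1=\pm\beta_2$; 3. $\mathcal J_{27}^{\alpha_1,\beta_1}\simeq\mathcal J_{27}^{\alpha_2,\beta_2}$ if and only if $(\alpha_1,\beta_1)=(\alpha_2,\beta_2)$ or $(\alpha_1,\beta_1)=(\beta_2,\alpha_2)$; 4. $\mathcal J_{41}^{\lambda_1}\simeq\mathcal J_{41}^{\lambda_2}$ if and only if $\lambda_1=\lambda_2$, or $\lambda_2\ne 0$ and $\lambda_1=\lambda_2^{-1}$; 5. $\mathcal J_{24}^1\simeq\epsilon_4$; 6. $\mathcal J_{29}\simeq\mathcal J_{24}^0$;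 7. $\mathcal J_{37}\simeq\mathcal J_{27}^{-1,-1}$; 8. $\mathcal J_{41}^{\lambda}\simeq\mathcal J_{27}^{\varepsilon,\varepsilon^{-1}}$ for $\lambda\neq 0,1$ and $\varepsilon=-\frac{(-1+\sqrt\lambda)^2}{(1+\sqrt\lambda)^2}$, for either choice of the square root $\sqrt\lambda$; and $\mathcal J_{41}^1\simeq\mathcal J_{26}^0$. -/

import Mathlib

namespace NilJordan

/-! ### Algebras given by multiplication tables -/

/-- The five basis elements `n1, …, n5`. -/
inductive Gen
  | n1 | n2 | n3 | n4 | n5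
  deriving DecidableEq

instance : Fintype Gen :=
  ⟨{.n1, .n2, .n3, .n4, .n5}, fun x => by cases x <;> decide⟩

/-- A commutative multiplication table on `n1, …, n5`. A row `(i, j, l, c)` says that the product
`i * j = j * i` contains the summand `c • l`. Products that do not occur are zero. -/
abbrev Table (k : Type*) := List (Gen × Gen × Gen × k)

/-- The coefficient of `l` in the product `i * j`. -/
def Table.coeff {k : Type*} [Field k] (T : Table k) (i j l : Gen) : k :=
  (T.map fun r =>
    if ((r.1 = i ∧ r.2.1 = j) ∨ (r.1 = j ∧ r.2.1 = i)) ∧ r.2.2.1 = l then r.2.2.2 else 0).sum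

theorem Table.coeff_comm {k : Type*} [Field k] (T : Table k) (i j l : Gen) :
    T.coeff i j l = T.coeff j i l := by
  unfold Table.coeff
  simp only [or_comm]

/-- The five-dimensional algebra with basis `n1, …, n5` and multiplication table `T`; an element
is the family of its coordinates. -/
def Table.Alg {k : Type*} (_T : Table k) : Type _ := Gen → k

namespace Table.Alg

variable {k : Type*} [Field k] (T : Table k)

instance : AddCommGroup T.Alg := inferInstanceAs (AddCommGroup (Gen → k))

instance : Module k T.Alg := inferInstanceAs (Module k (Gen → k))

/-- The bilinear extension of the multiplication table. -/
instance : Mul T.Alg :=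
  ⟨fun x y => (fun l => ∑ i, ∑ j, x i * y j * T.coeff i j l : Gen → k)⟩

theorem mul_apply (x y : T.Alg) (l : Gen) :
    (x * y) l = ∑ i, ∑ j, x i * y j * T.coeff i j l := rfl

instance : NonUnitalNonAssocCommRing T.Alg :=
  { (inferInstance : AddCommGroup T.Alg), (inferInstance : Mul T.Alg) with
    left_distrib := fun x y z => funext fun l => by
      change ∑ i, ∑ j, x i * (y j + z j) * T.coeff i j l =
        (∑ i, ∑ j, x i * y j * T.coeff i j l) + ∑ i, ∑ j, x i * z j * T.coeff i j l
      simp only [mul_add, add_mul, Finset.sum_add_distrib]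
    right_distrib := fun x y z => funext fun l => by
      change ∑ i, ∑ j, (x i + y i) * z j * T.coeff i j l =
        (∑ i, ∑ j, x i * z j * T.coeff i j l) + ∑ i, ∑ j, y i * z j * T.coeff i j l
      simp only [add_mul, Finset.sum_add_distrib]
    zero_mul := fun x => funext fun l => by
      change ∑ i, ∑ j, (0 : k) * x j * T.coeff i j l = 0
      simp
    mul_zero := fun x => funext fun l => by
      change ∑ i, ∑ j, x i * (0 : k) * T.coeff i j l = 0
      simp
    mul_comm := fun x y => funext fun l => by
      change ∑ i, ∑ j, x i * y j * T.coeff i j l = ∑ i, ∑ j, y i * x j * T.coeff i j l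
      rw [Finset.sum_comm]
      refine Finset.sum_congr rfl fun i _ => Finset.sum_congr rfl fun j _ => ?_
      rw [T.coeff_comm j i, mul_comm (x j)] }

instance : IsScalarTower k T.Alg T.Alg :=
  ⟨fun a x y => funext fun l => by
    change ∑ i, ∑ j, (a * x i) * y j * T.coeff i j l =
      a * ∑ i, ∑ j, x i * y j * T.coeff i j l
    simp only [Finset.mul_sum, mul_assoc]⟩

instance : SMulCommClass k T.Alg T.Alg :=
  ⟨fun a x y => by
    change a • (x * y) = x * (a • y)
    rw [mul_comm x y, mul_comm x (a • y), smul_mul_assoc]⟩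

end Table.Alg

/-! ### Nilpotency, associativity, isomorphism -/

/-- The powers of an algebra: `J ^ 1 = J` and
`J ^ n = J ^ (n - 1) * J + J ^ (n - 2) * J ^ 2 + ⋯ + J * J ^ (n - 1)`, the product of two
subspaces being the span of the products of their elements. (The value at `0` is a convention.) -/
def power (k A : Type*) [Field k] [NonUnitalNonAssocRing A] [Module k A] : ℕ → Submodule k A
  | 0 => ⊤
  | 1 => ⊤
  | n + 2 => ⨆ i : Fin (n + 1), Submodule.span k
      {z | ∃ x ∈ power k A (n + 1 - i), ∃ y ∈ power k A (i + 1), x * y = z}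
  decreasing_by all_goals omega

/-- Some power of the algebra vanishes. -/
def IsNilpotentAlg (k A : Type*) [Field k] [NonUnitalNonAssocRing A] [Module k A] : Prop :=
  ∃ n : ℕ, 1 ≤ n ∧ power k A n = ⊥

/-- The multiplication is associative. -/
def IsAssociative (A : Type*) [Mul A] : Prop :=
  ∀ x y z : A, (x * y) * z = x * (y * z)

/-- Isomorphism of (not necessarily associative) algebras over `k`. -/
def Isomorphic (k A B : Type*) [Field k] [NonUnitalNonAssocRing A] [Module k A]
    [NonUnitalNonAssocRing B] [Module k B] : Prop :=
  ∃ f : A ≃ₗ[k] B, ∀ x y : A, f (x * y) = f x * f y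

/-! ### The two lists of algebras -/

/-- The names of the listed algebras: `E1, …, E25` are the associative ones, and `J1, …, J41`
(six of them families with parameters in `k`) the others. -/
inductive Name (k : Type*)
  | E1 | E2 | E3 | E4 | E5 | E6 | E7 | E8 | E9 | E10 | E11 | E12 | E13 | E14 | E15 | E16 | E17
  | E18 | E19 | E20 | E21 | E22 | E23 | E24 | E25
  | J1 | J2 | J3 | J4 | J5 | J6 | J7 | J8 | J9 | J10 | J11 | J12 | J13 | J14 | J15 (α : k)
  | J16 | J17 | J18 | J19 | J20 | J21 | J22 | J23 (β : k) | J24 (γ : k) | J25 | J26 (δ : k)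
  | J27 (ε φ : k) | J28 | J29 | J30 | J31 | J32 | J33 | J34 | J35 | J36 | J37 | J38 | J39 | J40
  | J41 (l : k)

open Gen in
/-- The multiplication tables. Algebras that are described as direct sums are written out:
`k n` has zero product, and the other summands are `B_3`: `n1² = n2`; `T_3`: `n1² = n2`,
`n1 n2 = n3`; `T_4`: `n1² = n2² = n3`; and the four-dimensional `F_61, …, F_66, F_69, F_70`. -/
def Name.table {k : Type*} [Field k] : Name k → Table k
  | .E1 =>
    [(n1, n1, n2, 1), (n2, n2, n4, 1), (n1, n3, n4, 1), (n1, n2, n3, 1), (n1, n4, n5, 1), (n2, n3, n5, 1)]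
  | .E2 => [(n1, n1, n2, 1), (n2, n2, n4, 1), (n1, n3, n4, 1), (n1, n2, n3, 1), (n5, n5, n4, 1)]
  | .E3 => [(n1, n1, n2, 1), (n4, n4, n5, 1), (n1, n2, n3, 1), (n4, n5, n3, 1)]
  | .E4 => [(n1, n1, n3, 1), (n1, n2, n4, 1), (n1, n4, n5, 1), (n2, n3, n5, 1)]
  | .E5 => [(n1, n1, n2, 1), (n2, n2, n4, 1), (n1, n2, n3, 1), (n1, n3, n4, 1)] -- F_61 + k n5
  | .E6 => [(n1, n1, n2, 1), (n1, n2, n3, 1), (n4, n4, n5, 1)] -- T_3 + B_3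
  | .E7 => [(n1, n3, n4, 1), (n2, n3, n5, 1), (n1, n2, n4, 1), (n1, n2, n5, -1)]
  | .E8 => [(n1, n1, n3, 1), (n2, n2, n4, 1), (n1, n3, n4, 1), (n1, n2, n5, 1)]
  | .E9 => [(n1, n3, n5, 1), (n1, n2, n4, 1), (n2, n3, n5, -1)]
  | .E10 => [(n1, n1, n3, 1), (n1, n3, n4, 1), (n1, n2, n5, 1)]
  | .E11 => [(n1, n1, n4, 1), (n2, n3, n4, 1), (n1, n3, n5, 1)]
  | .E12 => [(n1, n2, n4, 1), (n1, n3, n5, 1)]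
  | .E13 => [(n3, n3, n4, 1), (n1, n2, n5, 1), (n3, n4, n5, 1)]
  | .E14 => [(n1, n1, n2, 1), (n4, n4, n3, 1), (n1, n2, n3, 1)] -- F_66 + k n5
  | .E15 => [(n1, n1, n3, 1), (n2, n2, n3, 1), (n4, n4, n5, 1)] -- T_4 + B_3
  | .E16 => [(n1, n1, n3, 1), (n2, n2, n5, 1), (n1, n2, n4, 1)]
  | .E17 => [(n1, n1, n4, 1), (n3, n3, n5, 1), (n1, n2, n5, 1)]
  | .E18 => [(n1, n1, n2, 1), (n1, n2, n3, 1)] -- T_3 + k n4 + k n5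
  | .E19 => [(n1, n1, n2, 1), (n3, n3, n4, 1)] -- B_3 + B_3 + k n5
  | .E20 => [(n1, n1, n2, 1), (n1, n3, n4, 1)] -- F_69 + k n5
  | .E21 => [(n2, n3, n5, 1), (n1, n4, n5, 1)]
  | .E22 => [(n1, n1, n2, 1), (n3, n4, n2, 1)] -- F_70 + k n5
  | .E23 => [(n1, n1, n3, 1), (n2, n2, n3, 1)] -- T_4 + k n4 + k n5
  | .E24 => [(n1, n1, n2, 1)] -- B_3 + k n3 + k n4 + k n5
  | .E25 => [] -- k n1 + ... + k n5
  | .J1 => [(n1, n1, n2, 1), (n1, n2, n3, 1), (n2, n4, n3, 1)] -- F_65 + k n5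
  | .J2 => [(n1, n1, n2, 1), (n4, n4, n2, -1), (n1, n2, n3, 1), (n2, n4, n3, 1)] -- F_64 + k n5
  | .J3 =>
    [(n1, n1, n2, 1), (n4, n4, n2, -1), (n4, n4, n3, -1), (n1, n2, n3, 1), (n2, n4, n3, 1)] -- F_63 + k n5
  | .J4 => [(n1, n1, n2, 1), (n4, n4, n2, 1), (n1, n2, n3, 1)] -- F_62 + k n5
  | .J5 => [(n1, n1, n2, 1), (n4, n4, n5, 1), (n2, n3, n5, 1)]
  | .J6 => [(n1, n1, n2, 1), (n1, n4, n5, 1), (n2, n3, n5, 1)]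
  | .J7 => [(n1, n2, n3, 1), (n3, n4, n5, 1)]
  | .J8 => [(n1, n2, n3, 1), (n3, n4, n5, 1), (n1, n1, n5, 1)]
  | .J9 => [(n1, n2, n3, 1), (n3, n4, n5, 1), (n1, n1, n5, 1), (n2, n2, n5, 1)]
  | .J10 => [(n1, n2, n3, 1), (n1, n3, n5, 1), (n4, n4, n5, 1), (n2, n3, n5, 1)]
  | .J11 => [(n1, n2, n3, 1), (n1, n3, n5, 1), (n4, n4, n5, 1)]
  | .J12 => [(n1, n2, n3, 1), (n1, n3, n5, 1), (n4, n4, n5, 1), (n2, n2, n5, 1)]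
  | .J13 => [(n1, n2, n3, 1), (n1, n4, n5, 1), (n1, n3, n5, 1), (n2, n3, n5, 1)]
  | .J14 => [(n1, n2, n3, 1), (n1, n3, n5, 1), (n2, n4, n5, 1)]
  | .J15 α =>
    [(n1, n1, n2, 1), (n1, n2, n3, 1), (n4, n4, n5, α), (n2, n2, n5, 1), (n1, n3, n5, 1), (n2, n4, n5, 1)]
  | .J16 => [(n1, n2, n4, 1), (n3, n3, n4, 1), (n1, n4, n5, 1)]
  | .J17 => [(n1, n2, n4, 1), (n3, n3, n4, 1), (n1, n4, n5, 1), (n2, n3, n5, 1)]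
  | .J18 => [(n1, n2, n4, 1), (n3, n3, n4, 1), (n1, n4, n5, 1), (n2, n2, n5, 1)]
  | .J19 => [(n1, n2, n4, 1), (n3, n3, n4, 1), (n3, n4, n5, 1)]
  | .J20 => [(n1, n2, n4, 1), (n3, n3, n4, 1), (n3, n4, n5, 1), (n1, n1, n5, 1)]
  | .J21 => [(n1, n2, n4, 1), (n3, n3, n4, 1), (n3, n4, n5, 1), (n1, n1, n5, 1), (n2, n2, n5, 1)]
  | .J22 => [(n1, n1, n2, 1), (n1, n2, n4, 1), (n3, n3, n4, 1), (n2, n2, n5, 1), (n1, n4, n5, 1)]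
  | .J23 β => [(n1, n1, n3, 1), (n1, n3, n5, 1), (n2, n4, n5, 1), (n1, n2, n4, 1), (n2, n3, n5, β)]
  | .J24 γ => [(n1, n1, n3, 1), (n1, n2, n4, 1), (n2, n3, n5, 1), (n1, n4, n5, γ)]
  | .J25 => [(n1, n1, n3, 1), (n1, n2, n4, 1), (n1, n3, n5, 1), (n1, n4, n5, 1), (n2, n3, n5, -2)]
  | .J26 δ => [(n1, n1, n3, 1), (n2, n2, n4, 1), (n2, n4, n5, δ), (n1, n3, n5, 1), (n1, n4, n5, 1)]
  | .J27 ε φ =>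
    [(n1, n1, n3, 1), (n2, n3, n5, 1), (n1, n4, n5, 1), (n2, n2, n4, 1), (n2, n4, n5, ε), (n1, n3, n5, φ)]
  | .J28 => [(n1, n1, n2, 1), (n2, n3, n4, 1), (n3, n3, n5, 1)]
  | .J29 => [(n1, n1, n2, 1), (n2, n3, n4, 1), (n1, n3, n5, 1)]
  | .J30 => [(n1, n1, n2, 1), (n2, n3, n4, 1), (n1, n3, n5, 1), (n3, n3, n5, 1)]
  | .J31 => [(n1, n1, n2, 1), (n2, n3, n4, 1), (n1, n2, n5, 1)]
  | .J32 => [(n1, n1, n2, 1), (n2, n3, n4, 1), (n1, n2, n5, 1), (n1, n3, n5, 1)]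
  | .J33 => [(n1, n1, n2, 1), (n2, n3, n4, 1), (n1, n2, n5, 1), (n3, n3, n5, 1)]
  | .J34 => [(n1, n2, n3, 1), (n1, n3, n4, 1), (n1, n1, n5, 1)]
  | .J35 => [(n1, n2, n3, 1), (n1, n3, n4, 1), (n2, n2, n5, 1)]
  | .J36 => [(n1, n2, n3, 1), (n1, n3, n4, 1), (n2, n3, n5, 1)]
  | .J37 => [(n1, n1, n5, 1), (n2, n2, n5, 1), (n1, n2, n3, 1), (n1, n3, n4, 1)]
  | .J38 => [(n1, n2, n3, 1), (n1, n3, n4, 1), (n1, n1, n5, 1), (n2, n3, n5, 1)]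
  | .J39 => [(n1, n2, n3, 1), (n1, n1, n5, 1), (n2, n2, n4, 1), (n1, n3, n4, 1)]
  | .J40 => [(n1, n2, n3, 1), (n2, n2, n4, 1), (n1, n3, n4, 1), (n1, n1, n5, 1), (n2, n3, n5, 1)]
  | .J41 l => [(n1, n1, n5, 1), (n1, n2, n3, 1), (n2, n2, n5, l), (n1, n3, n4, 1), (n2, n3, n4, 1)]

/-- The listed algebra with the given name. -/
abbrev Name.Alg {k : Type*} [Field k] (a : Name k) : Type _ := a.table.Alg

/-- The name belongs to the list `E1, …, E25`. -/
def Name.IsE {k : Type*} : Name k → Prop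
  | .E1 | .E2 | .E3 | .E4 | .E5 | .E6 | .E7 | .E8 | .E9 | .E10 | .E11 | .E12 | .E13 | .E14
  | .E15 | .E16 | .E17 | .E18 | .E19 | .E20 | .E21 | .E22 | .E23 | .E24 | .E25 => True
  | _ => False

/-- The coincidences between differently named algebras (each in one of its two directions). -/
inductive Coincide {k : Type*} [Field k] : Name k → Name k → Prop
  | j23 (β : k) : Coincide (.J23 β) (.J23 (-β))
  | j26 (δ : k) : Coincide (.J26 δ) (.J26 (-δ))
  | j27 (ε φ : k) : Coincide (.J27 ε φ) (.J27 φ ε)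
  | j41 (l : k) (hl : l ≠ 0) : Coincide (.J41 l) (.J41 l⁻¹)
  | j24_one : Coincide (.J24 1) .E4
  | j29 : Coincide .J29 (.J24 0)
  | j37 : Coincide .J37 (.J27 (-1) (-1))
  | j41_j27 (l s ε : k) (h0 : l ≠ 0) (h1 : l ≠ 1) (hs : s ^ 2 = l)
      (hε : ε = -((-1 + s) ^ 2 / (1 + s) ^ 2)) : Coincide (.J41 l) (.J27 ε ε⁻¹)
  | j41_one : Coincide (.J41 1) (.J26 0)

end NilJordan

namespace NilJordan

set_option linter.unusedSectionVars false

variable {k : Type*} [Field k]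

/-! ### Products in coordinates -/

/-- The contribution of a row of the table to the coordinate `l` of the product `x * y`. -/
def rowMul (x y : Gen → k) (l : Gen) (r : Gen × Gen × Gen × k) : k :=
  if r.2.2.1 = l then
    r.2.2.2 * (if r.1 = r.2.1 then x r.1 * y r.1 else x r.1 * y r.2.1 + x r.2.1 * y r.1)
  else 0

theorem sum_gen {M : Type*} [AddCommMonoid M] (f : Gen → M) :
    ∑ i, f i = f .n1 + f .n2 + f .n3 + f .n4 + f .n5 := by
  have : (Finset.univ : Finset Gen) = {.n1, .n2, .n3, .n4, .n5} := by decide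
  rw [this]
  rw [Finset.sum_insert (by decide), Finset.sum_insert (by decide), Finset.sum_insert (by decide),
    Finset.sum_insert (by decide), Finset.sum_singleton]
  simp only [add_assoc]

theorem forall_gen {p : Gen → Prop} : (∀ i, p i) ↔ p .n1 ∧ p .n2 ∧ p .n3 ∧ p .n4 ∧ p .n5 :=
  ⟨fun h => ⟨h _, h _, h _, h _, h _⟩, fun ⟨h1, h2, h3, h4, h5⟩ i => by cases i <;> assumption⟩

theorem mul_apply_rows (T : Table k) (x y : T.Alg) (l : Gen) :
    (x * y) l = (T.map (rowMul x y l)).sum := by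
  rw [Table.Alg.mul_apply]
  have key : ∀ S : Table k, ∑ i, ∑ j, x i * y j * S.coeff i j l = (S.map (rowMul x y l)).sum := by
    intro S
    induction S with
    | nil => simp [Table.coeff]
    | cons r S ih =>
      have hc : ∀ i j, Table.coeff (r :: S) i j l =
          (if ((r.1 = i ∧ r.2.1 = j) ∨ (r.1 = j ∧ r.2.1 = i)) ∧ r.2.2.1 = l then r.2.2.2 else 0) +
            Table.coeff S i j l := fun i j => by simp [Table.coeff]
      simp only [hc, mul_add, Finset.sum_add_distrib, ih, List.map_cons, List.sum_cons]
      congr 1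
      obtain ⟨a, b, m, c⟩ := r
      by_cases hm : m = l
      · cases a <;> cases b <;> simp [rowMul, hm, sum_gen] <;> ring
      · simp [rowMul, hm]
  exact key T

@[simp] theorem add_coord (T : Table k) (x y : T.Alg) (l : Gen) : (x + y) l = x l + y l := rfl
@[simp] theorem neg_coord (T : Table k) (x : T.Alg) (l : Gen) : (-x) l = -x l := rfl
@[simp] theorem zero_coord (T : Table k) (l : Gen) : (0 : T.Alg) l = 0 := rfl
@[simp] theorem smul_coord (T : Table k) (c : k) (x : T.Alg) (l : Gen) : (c • x) l = c * x l := rfl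

theorem alg_ext {T : Table k} {x y : T.Alg} (h : ∀ l, x l = y l) : x = y := funext h

theorem eq_zero_iff {T : Table k} {x : T.Alg} :
    x = 0 ↔ x .n1 = 0 ∧ x .n2 = 0 ∧ x .n3 = 0 ∧ x .n4 = 0 ∧ x .n5 = 0 :=
  ⟨fun h => by simp [h], fun h => alg_ext (forall_gen.2 h)⟩

/-- The basis element with index `i`. -/
def bas (T : Table k) (i : Gen) : T.Alg := fun j => if i = j then 1 else 0

theorem bas_apply (T : Table k) (i j : Gen) : bas T i j = if i = j then 1 else 0 := rfl

theorem bas_mul_bas (T : Table k) (i j l : Gen) : (bas T i * bas T j) l = T.coeff i j l := by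
  rw [Table.Alg.mul_apply]
  simp [bas_apply]

theorem bas_mul (T : Table k) (i : Gen) (x : T.Alg) (l : Gen) :
    (bas T i * x) l = ∑ j, x j * T.coeff i j l := by
  rw [Table.Alg.mul_apply]
  simp [bas_apply]

theorem mul_bas (T : Table k) (i : Gen) (x : T.Alg) (l : Gen) :
    (x * bas T i) l = ∑ j, x j * T.coeff j i l := by
  rw [Table.Alg.mul_apply]
  simp [bas_apply]

theorem sum_bas (T : Table k) (x : T.Alg) : x = ∑ i, x i • bas T i := by
  refine alg_ext fun l => ?_
  have : ∀ s : Finset Gen, (∑ i ∈ s, x i • bas T i : T.Alg) l = ∑ i ∈ s, x i * bas T i l := by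
    intro s
    induction s using Finset.induction with
    | empty => rfl
    | insert a s ha ih => rw [Finset.sum_insert ha, Finset.sum_insert ha, add_coord, ih]; rfl
  rw [this, Finset.sum_eq_single l]
  · rw [bas_apply, if_pos rfl, mul_one]
  · intro i _ hi; rw [bas_apply, if_neg hi, mul_zero]
  · intro h; exact absurd (Finset.mem_univ _) h

/-! ### Subspaces defined by formulas -/

/-- Formulas for subspaces that can be formed in every algebra: `mul φ ψ` stands for the span of
the products, and `colon φ ψ` for the elements that multiply `φ` into `ψ`. -/
inductive Fm
  | top | bot
  | mul (φ ψ : Fm)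
  | colon (φ ψ : Fm)
  | inf (φ ψ : Fm)

namespace Fm

section Eval

variable (k) (A : Type*) [NonUnitalNonAssocCommRing A] [Module k A] [IsScalarTower k A A]

/-- The value of a formula in an algebra. -/
def eval : Fm → Submodule k A
  | top => ⊤
  | bot => ⊥
  | mul φ ψ => Submodule.span k {z | ∃ x ∈ eval φ, ∃ y ∈ eval ψ, x * y = z}
  | colon φ ψ =>
    { carrier := {x | ∀ y ∈ eval φ, x * y ∈ eval ψ}
      add_mem' := fun {a b} ha hb y hy => by
        rw [add_mul]; exact Submodule.add_mem _ (ha y hy) (hb y hy)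
      zero_mem' := fun y _ => by rw [zero_mul]; exact Submodule.zero_mem _
      smul_mem' := fun c x hx y hy => by
        rw [smul_mul_assoc]; exact Submodule.smul_mem _ _ (hx y hy) }
  | inf φ ψ => eval φ ⊓ eval ψ

end Eval

variable {A B : Type*} [NonUnitalNonAssocCommRing A] [Module k A] [IsScalarTower k A A]
  [NonUnitalNonAssocCommRing B] [Module k B] [IsScalarTower k B B]

theorem mem_colon {φ ψ : Fm} {x : A} :
    x ∈ (colon φ ψ).eval k A ↔ ∀ y ∈ φ.eval k A, x * y ∈ ψ.eval k A := Iff.rfl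

theorem map_eval (f : A ≃ₗ[k] B) (hf : ∀ x y, f (x * y) = f x * f y) (φ : Fm) :
    (φ.eval k A).map f.toLinearMap = φ.eval k B := by
  induction φ with
  | top => simp [eval]
  | bot => simp [eval]
  | mul φ ψ ih1 ih2 =>
    simp only [eval, Submodule.map_span, ← ih1, ← ih2]
    congr 1
    ext z
    constructor
    · rintro ⟨_, ⟨x, hx, y, hy, rfl⟩, rfl⟩
      exact ⟨f x, ⟨x, hx, rfl⟩, f y, ⟨y, hy, rfl⟩, (hf x y).symm⟩
    · rintro ⟨_, ⟨x, hx, rfl⟩, _, ⟨y, hy, rfl⟩, rfl⟩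
      exact ⟨x * y, ⟨x, hx, y, hy, rfl⟩, hf x y⟩
  | colon φ ψ ih1 ih2 =>
    ext z
    obtain ⟨z, rfl⟩ := f.surjective z
    have h : f z ∈ ((colon φ ψ).eval k A).map f.toLinearMap ↔ z ∈ (colon φ ψ).eval k A :=
      (Submodule.mem_map_equiv (e := f) _).trans (by simp)
    rw [h, mem_colon, mem_colon, ← ih1, ← ih2]
    constructor
    · rintro h _ ⟨y, hy, rfl⟩
      exact ⟨z * y, h y hy, hf z y⟩
    · intro h y hy
      obtain ⟨w, hw, e⟩ := h (f y) ⟨y, hy, rfl⟩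
      have : w = z * y := f.injective (e.trans (hf z y).symm)
      exact this ▸ hw
  | inf φ ψ ih1 ih2 =>
    simp only [eval, ← ih1, ← ih2]
    exact Submodule.map_inf _ f.injective

theorem map_mem_eval (f : A ≃ₗ[k] B) (hf : ∀ x y, f (x * y) = f x * f y) (φ : Fm) (x : A) :
    f x ∈ φ.eval k B ↔ x ∈ φ.eval k A := by
  rw [← map_eval f hf φ]
  exact (Submodule.mem_map_equiv (e := f) _).trans (by simp)

theorem finrank_eval (f : A ≃ₗ[k] B) (hf : ∀ x y, f (x * y) = f x * f y) (φ : Fm) :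
    Module.finrank k (φ.eval k A) = Module.finrank k (φ.eval k B) := by
  rw [← map_eval f hf φ]
  exact (LinearEquiv.finrank_map_eq f _).symm

end Fm

/-! ### Combinatorial evaluation of formulas -/

/-- The subspace spanned by the basis elements in `s`. -/
def coord (T : Table k) (s : Gen → Bool) : Submodule k T.Alg where
  carrier := {x | ∀ l, s l = false → x l = 0}
  add_mem' := fun ha hb l hl => by rw [add_coord, ha l hl, hb l hl, add_zero]
  zero_mem' := fun _ _ => rfl
  smul_mem' := fun c x hx l hl => by rw [smul_coord, hx l hl, mul_zero]

theorem mem_coord {T : Table k} {s : Gen → Bool} {x : T.Alg} :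
    x ∈ coord T s ↔ ∀ l, s l = false → x l = 0 := Iff.rfl

theorem bas_mem_coord {T : Table k} {s : Gen → Bool} {i : Gen} (h : s i = true) :
    bas T i ∈ coord T s := fun l hl => by
  rw [bas_apply, if_neg]
  rintro rfl
  simp [h] at hl

theorem coord_le {T : Table k} {s : Gen → Bool} {U : Submodule k T.Alg}
    (h : ∀ l, s l = true → bas T l ∈ U) : coord T s ≤ U := fun x hx => by
  rw [sum_bas T x]
  refine Submodule.sum_mem _ fun l _ => ?_
  cases hl : s l with
  | false => rw [hx l hl, zero_smul]; exact Submodule.zero_mem _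
  | true => exact Submodule.smul_mem _ _ (h l hl)

theorem finrank_coord (T : Table k) (s : Gen → Bool) :
    Module.finrank k (coord T s) = (Finset.univ.filter fun l => s l = true).card := by
  have e : coord T s ≃ₗ[k] ({l // s l = true} → k) :=
    { toFun := fun x l => x.1 l
      map_add' := fun _ _ => rfl
      map_smul' := fun _ _ => rfl
      invFun := fun y => ⟨fun l => if h : s l = true then y ⟨l, h⟩ else 0, fun l hl => by simp [hl]⟩
      left_inv := fun x => by
        refine Subtype.ext (alg_ext fun l => ?_)
        change (if h : s l = true then x.1 l else 0) = x.1 l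
        cases hl : s l with
        | false => simpa using (x.2 l hl).symm
        | true => simp
      right_inv := fun y => by
        funext l
        change (if h : s l = true then y ⟨l, h⟩ else 0) = y l
        rw [dif_pos l.2] }
  rw [e.finrank_eq, Module.finrank_fintype_fun_eq_card, Fintype.card_subtype]

/-- A triple `(i, j, l)` stands for the basis element `l` occurring in the product `i * j`. -/
abbrev Pat := List (Gen × Gen × Gen)

/-- The triple `(i, j, l)` or `(j, i, l)` is in the list. -/
def Pat.rel (p : Pat) (i j l : Gen) : Bool :=
  p.any fun r => r == (i, j, l) || r == (j, i, l)

/-- The triples of a table. -/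
def Table.pat (T : Table k) : Pat := T.map fun r => (r.1, r.2.1, r.2.2.1)

theorem rel_pat_of_coeff_ne_zero {T : Table k} {i j l : Gen} (h : T.coeff i j l ≠ 0) :
    T.pat.rel i j l = true := by
  unfold Table.coeff at h
  by_contra hc
  apply h
  refine List.sum_eq_zero fun x hx => ?_
  obtain ⟨r, hr, rfl⟩ := List.mem_map.1 hx
  refine if_neg fun hm => hc ?_
  rw [Pat.rel, List.any_eq_true]
  refine ⟨_, List.mem_map.2 ⟨r, hr, rfl⟩, ?_⟩
  obtain ⟨⟨h1, h2⟩ | ⟨h1, h2⟩, h3⟩ := hm <;> simp [h1, h2, h3]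

/-- All basis elements of a list of indices satisfy a boolean condition. -/
def allGen (f : Gen → Bool) : Bool := f .n1 && f .n2 && f .n3 && f .n4 && f .n5

theorem allGen_iff {f : Gen → Bool} : allGen f = true ↔ ∀ i, f i = true := by
  simp [allGen, forall_gen, and_assoc]

namespace Fm

/-- Lower (`true`) and upper (`false`) combinatorial bounds for the value of a formula. The list
`U` holds all triples of the table, `L` those with `i * j` a nonzero multiple of `l`, and `M` those
where `i` is the only basis element whose product with `j` involves `l`. -/
def comb (U L M : Pat) : Fm → Bool → Gen → Bool
  | top, _ => fun _ => true
  | bot, _ => fun _ => false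
  | mul φ ψ, b =>
    fun l => (if b then L else U).any fun r => r.2.2 == l &&
      ((φ.comb U L M b r.1 && ψ.comb U L M b r.2.1) ||
        (φ.comb U L M b r.2.1 && ψ.comb U L M b r.1))
  | colon φ ψ, b => fun i =>
    if b then
      U.all fun r => ψ.comb U L M true r.2.2 ||
        !((r.1 == i && φ.comb U L M false r.2.1) || (r.2.1 == i && φ.comb U L M false r.1))
    else
      M.all fun r => !(r.1 == i && φ.comb U L M true r.2.1) || ψ.comb U L M false r.2.2
  | inf φ ψ, b => fun l => φ.comb U L M b l && ψ.comb U L M b l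

theorem comb_le_eval_le {T : Table k} {U L M : Pat}
    (hU : ∀ i j l, T.coeff i j l ≠ 0 → U.rel i j l = true)
    (hL : ∀ r ∈ L, T.coeff r.1 r.2.1 r.2.2 ≠ 0 ∧ ∀ l, l ≠ r.2.2 → T.coeff r.1 r.2.1 l = 0)
    (hM : ∀ r ∈ M, T.coeff r.1 r.2.1 r.2.2 ≠ 0 ∧ ∀ i, i ≠ r.1 → T.coeff i r.2.1 r.2.2 = 0)
    (φ : Fm) :
    coord T (φ.comb U L M true) ≤ φ.eval k T.Alg ∧
      φ.eval k T.Alg ≤ coord T (φ.comb U L M false) := by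
  induction φ with
  | top => exact ⟨le_top, fun x _ l hl => by simp [comb] at hl⟩
  | bot =>
    refine ⟨fun x hx => ?_, bot_le⟩
    exact (Submodule.mem_bot k).2 (alg_ext fun l => hx l rfl)
  | mul φ ψ ih1 ih2 =>
    constructor
    · refine coord_le fun l hl => ?_
      simp only [comb, if_true, List.any_eq_true, Bool.and_eq_true, Bool.or_eq_true, beq_iff_eq]
        at hl
      obtain ⟨⟨i, j, m⟩, hr, rfl, hs⟩ := hl
      have hprod : bas T i * bas T j ∈ (mul φ ψ).eval k T.Alg := by
        rcases hs with hs | hs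
        · exact Submodule.subset_span
            ⟨_, ih1.1 (bas_mem_coord hs.1), _, ih2.1 (bas_mem_coord hs.2), rfl⟩
        · exact Submodule.subset_span
            ⟨_, ih1.1 (bas_mem_coord hs.1), _, ih2.1 (bas_mem_coord hs.2), mul_comm _ _⟩
      obtain ⟨h0, h1⟩ := hL _ hr
      have : bas T m = (T.coeff i j m)⁻¹ • (bas T i * bas T j) := by
        refine alg_ext fun l => ?_
        rw [smul_coord, bas_mul_bas, bas_apply]
        by_cases h : m = l
        · subst h; rw [if_pos rfl, inv_mul_cancel₀ h0]
        · rw [if_neg h, h1 l (Ne.symm h), mul_zero]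
      change bas T m ∈ _
      rw [this]
      exact Submodule.smul_mem _ _ hprod
    · refine Submodule.span_le.2 ?_
      rintro _ ⟨x, hx, y, hy, rfl⟩ l hl
      rw [Table.Alg.mul_apply]
      refine Finset.sum_eq_zero fun i _ => Finset.sum_eq_zero fun j _ => ?_
      by_cases hc : T.coeff i j l = 0
      · rw [hc, mul_zero]
      have hr := hU i j l hc
      simp only [Pat.rel, List.any_eq_true, Bool.or_eq_true, beq_iff_eq] at hr
      simp only [comb, Bool.false_eq_true, if_false, List.any_eq_false, Bool.and_eq_true,
        Bool.or_eq_true, beq_iff_eq] at hl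
      have hxy : ¬ (φ.comb U L M false i = true ∧ ψ.comb U L M false j = true) := by
        intro h
        obtain ⟨r, hr, rfl | rfl⟩ := hr
        · exact hl _ hr ⟨rfl, Or.inl h⟩
        · exact hl _ hr ⟨rfl, Or.inr h⟩
      rcases not_and_or.1 hxy with h | h
      · rw [ih1.2 hx i (by simpa using h), zero_mul, zero_mul]
      · rw [ih2.2 hy j (by simpa using h), mul_zero, zero_mul]
  | colon φ ψ ih1 ih2 =>
    constructor
    · refine coord_le fun i hi y hy => ih2.1 fun l hl => ?_
      rw [bas_mul]
      refine Finset.sum_eq_zero fun j _ => ?_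
      by_cases hc : T.coeff i j l = 0
      · rw [hc, mul_zero]
      have hr := hU i j l hc
      simp only [Pat.rel, List.any_eq_true, Bool.or_eq_true, beq_iff_eq] at hr
      simp only [comb, if_true, List.all_eq_true, Bool.or_eq_true, Bool.not_eq_true',
        Bool.or_eq_false_iff, Bool.and_eq_false_iff, beq_eq_false_iff_ne] at hi
      have : φ.comb U L M false j = false := by
        obtain ⟨r, hr, rfl | rfl⟩ := hr
        · have := hi _ hr
          simp [hl] at this
          exact this.1
        · have := hi _ hr
          simp [hl] at this
          exact this.2
      rw [ih1.2 hy j this, zero_mul]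
    · intro x hx i hi
      simp only [comb, Bool.false_eq_true, if_false, List.all_eq_false, Bool.or_eq_true,
        Bool.not_eq_true', not_or, Bool.and_eq_false_iff, beq_eq_false_iff_ne,
        ne_eq, not_not, Bool.not_eq_true, Bool.not_eq_false] at hi
      obtain ⟨⟨i', j, l⟩, hr, ⟨rfl, hj⟩, hl⟩ := hi
      obtain ⟨h0, h1⟩ := hM _ hr
      have hz := ih2.2 (hx _ (ih1.1 (bas_mem_coord hj))) l hl
      rw [mul_bas, Finset.sum_eq_single i'] at hz
      · exact (mul_eq_zero.1 hz).resolve_right h0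
      · intro b _ hb; rw [h1 b hb, mul_zero]
      · intro h; exact absurd (Finset.mem_univ _) h
  | inf φ ψ ih1 ih2 =>
    constructor
    · intro x hx
      refine ⟨ih1.1 fun l hl => hx l ?_, ih2.1 fun l hl => hx l ?_⟩ <;> simp [comb, hl]
    · rintro x ⟨h1, h2⟩ l hl
      simp only [comb, Bool.and_eq_false_iff] at hl
      rcases hl with h | h
      · exact ih1.2 h1 l h
      · exact ih2.2 h2 l h

end Fm

/-! ### The dimensions of the powers -/

/-- Two rows belong to different products of basis elements. -/
def Pat.Apart (r q : Gen × Gen × Gen) : Prop :=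
  ¬ ((r.1 = q.1 ∧ r.2.1 = q.2.1) ∨ (r.1 = q.2.1 ∧ r.2.1 = q.1))

instance (r q : Gen × Gen × Gen) : Decidable (Pat.Apart r q) := by
  unfold Pat.Apart; infer_instance

theorem Table.coeff_cons (r : Gen × Gen × Gen × k) (T : Table k) (i j l : Gen) :
    Table.coeff (r :: T) i j l =
      (if ((r.1 = i ∧ r.2.1 = j) ∨ (r.1 = j ∧ r.2.1 = i)) ∧ r.2.2.1 = l then r.2.2.2 else 0) +
        T.coeff i j l := by
  simp [Table.coeff]

theorem Table.coeff_eq_zero_of_apart {T : Table k} {i j : Gen}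
    (h : ∀ q ∈ T.pat, ∀ l, Pat.Apart (i, j, l) q) (l : Gen) : T.coeff i j l = 0 := by
  by_contra hc
  have := rel_pat_of_coeff_ne_zero hc
  simp only [Pat.rel, List.any_eq_true, Bool.or_eq_true, beq_iff_eq] at this
  obtain ⟨q, hq, rfl | rfl⟩ := this
  · exact h _ hq l (Or.inl ⟨rfl, rfl⟩)
  · exact h _ hq l (Or.inr ⟨rfl, rfl⟩)

/-- If every product of basis elements has at most one row, then the coefficients are those listed
in the rows. -/
theorem Table.coeff_of_pairwise {T : Table k} (hT : T.pat.Pairwise Pat.Apart) :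
    ∀ r ∈ T, T.coeff r.1 r.2.1 r.2.2.1 = r.2.2.2 ∧
      ∀ l, l ≠ r.2.2.1 → T.coeff r.1 r.2.1 l = 0 := by
  induction T with
  | nil => simp
  | cons q T ih =>
    have hT' := List.pairwise_cons.1
      (show List.Pairwise _ ((q.1, q.2.1, q.2.2.1) :: Table.pat T) from hT)
    intro r hr
    rcases List.mem_cons.1 hr with rfl | hr
    · have h0 : ∀ l, Table.coeff T r.1 r.2.1 l = 0 :=
        Table.coeff_eq_zero_of_apart fun q hq l => hT'.1 q hq
      refine ⟨by simp [Table.coeff_cons, h0], fun l hl => ?_⟩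
      rw [Table.coeff_cons, h0, add_zero, if_neg fun h => hl h.2.symm]
    · have ha := hT'.1 (r.1, r.2.1, r.2.2.1) (List.mem_map.2 ⟨r, hr, rfl⟩)
      have h0 : ∀ l, Table.coeff (q :: T) r.1 r.2.1 l = Table.coeff T r.1 r.2.1 l := fun l => by
        rw [Table.coeff_cons, if_neg (fun h => ha h.1), zero_add]
      simp only [h0]
      exact ih hT'.2 r hr

theorem Table.coeff_of_pairwise' {T : Table k} (hT : T.pat.Pairwise Pat.Apart) {L : Pat}
    (hL : ∀ q ∈ L, ∃ r ∈ T, (r.1, r.2.1, r.2.2.1) = q ∧ r.2.2.2 ≠ 0) :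
    ∀ r ∈ L, T.coeff r.1 r.2.1 r.2.2 ≠ 0 ∧ ∀ l, l ≠ r.2.2 → T.coeff r.1 r.2.1 l = 0 := by
  intro q hq
  obtain ⟨r, hr, rfl, h0⟩ := hL q hq
  obtain ⟨h1, h2⟩ := Table.coeff_of_pairwise hT r hr
  exact ⟨by rw [h1]; exact h0, h2⟩

open Gen in
/-- Triples `(i, j, l)` such that `i * j` is a nonzero multiple of `l`. -/
def Name.low : Name k → Pat
  | .E7 => [(n1, n3, n4), (n2, n3, n5)]
  | .J3 => [(n1, n1, n2), (n1, n2, n3)]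
  | .J15 _ => [(n1, n1, n2), (n1, n2, n3), (n2, n2, n5), (n1, n3, n5)]
  | .J23 _ => [(n1, n1, n3), (n1, n2, n4), (n1, n3, n5)]
  | .J24 _ => [(n1, n1, n3), (n1, n2, n4), (n2, n3, n5)]
  | .J26 _ => [(n1, n1, n3), (n2, n2, n4), (n1, n3, n5)]
  | .J27 _ _ => [(n1, n1, n3), (n2, n2, n4), (n2, n3, n5)]
  | .J41 _ => [(n1, n1, n5), (n1, n2, n3), (n1, n3, n4)]
  | .J25 => [(n1, n1, n3), (n1, n2, n4), (n1, n3, n5)]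
  | a => a.table.pat

/-- The same name over `ℚ`, with all parameters replaced by `0`. -/
def Name.toRat : Name k → Name ℚ
  | .E1 => .E1 | .E2 => .E2 | .E3 => .E3 | .E4 => .E4 | .E5 => .E5 | .E6 => .E6 | .E7 => .E7
  | .E8 => .E8 | .E9 => .E9 | .E10 => .E10 | .E11 => .E11 | .E12 => .E12 | .E13 => .E13
  | .E14 => .E14 | .E15 => .E15 | .E16 => .E16 | .E17 => .E17 | .E18 => .E18 | .E19 => .E19
  | .E20 => .E20 | .E21 => .E21 | .E22 => .E22 | .E23 => .E23 | .E24 => .E24 | .E25 => .E25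
  | .J1 => .J1 | .J2 => .J2 | .J3 => .J3 | .J4 => .J4 | .J5 => .J5 | .J6 => .J6 | .J7 => .J7
  | .J8 => .J8 | .J9 => .J9 | .J10 => .J10 | .J11 => .J11 | .J12 => .J12 | .J13 => .J13
  | .J14 => .J14 | .J15 _ => .J15 0 | .J16 => .J16 | .J17 => .J17 | .J18 => .J18 | .J19 => .J19
  | .J20 => .J20 | .J21 => .J21 | .J22 => .J22 | .J23 _ => .J23 0 | .J24 _ => .J24 0
  | .J25 => .J25 | .J26 _ => .J26 0 | .J27 _ _ => .J27 0 0 | .J28 => .J28 | .J29 => .J29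
  | .J30 => .J30 | .J31 => .J31 | .J32 => .J32 | .J33 => .J33 | .J34 => .J34 | .J35 => .J35
  | .J36 => .J36 | .J37 => .J37 | .J38 => .J38 | .J39 => .J39 | .J40 => .J40 | .J41 _ => .J41 0

theorem Name.pat_toRat (a : Name k) : a.table.pat = a.toRat.table.pat := by cases a <;> rfl

theorem Name.low_toRat (a : Name k) : a.low = a.toRat.low := by cases a <;> rfl

theorem Name.coeff_low (a : Name k) :
    ∀ r ∈ a.low, a.table.coeff r.1 r.2.1 r.2.2 ≠ 0 ∧
      ∀ l, l ≠ r.2.2 → a.table.coeff r.1 r.2.1 l = 0 := by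
  by_cases h : a.table.pat.Pairwise Pat.Apart
  · refine Table.coeff_of_pairwise' h ?_
    cases a <;> simp [Name.low, Name.table, Table.pat]
  · rw [a.pat_toRat] at h
    cases a
    case E7 | J3 => simp [Name.low, Name.table, Table.coeff, forall_gen]
    all_goals exact absurd (by simp only [Name.toRat]; decide +kernel) h

namespace Fm

/-- The square, the cube and the fourth power. -/
def sq : Fm := mul top top
def cube : Fm := mul sq top
def fourth : Fm := mul cube top

end Fm

/-- The dimensions of the square, the cube and the fourth power. -/
def Name.sig : Name k → ℕ × ℕ × ℕ
  | .E25 => (0, 0, 0)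
  | .E21 | .E22 | .E23 | .E24 => (1, 0, 0)
  | .E7 | .E9 | .E11 | .E12 | .E15 | .E17 | .E19 | .E20 => (2, 0, 0)
  | .E16 => (3, 0, 0)
  | .J31 | .J32 | .J33 | .J36 | .J38 | .J40 => (3, 2, 0)
  | .E2 | .E5 | .J15 _ | .J22 => (3, 2, 1)
  | .E1 => (4, 3, 2)
  | .E13 | .E14 | .E18 | .J1 | .J2 | .J3 | .J4 | .J5 | .J6 | .J7 | .J8 | .J9 | .J10 | .J11 | .J12
  | .J13 | .J14 | .J16 | .J17 | .J18 | .J19 | .J20 | .J21 => (2, 1, 0)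
  | _ => (3, 1, 0)

/-- The lower and upper combinatorial bounds for the value of a formula are both equal to `s`. -/
def Fm.Exact (U L M : Pat) (φ : Fm) (s : Gen → Bool) : Bool :=
  allGen fun l => (s l == φ.comb U L M true l) && (s l == φ.comb U L M false l)

theorem Fm.eval_eq_of_exact {T : Table k} {U L M : Pat}
    (hU : ∀ i j l, T.coeff i j l ≠ 0 → U.rel i j l = true)
    (hL : ∀ r ∈ L, T.coeff r.1 r.2.1 r.2.2 ≠ 0 ∧ ∀ l, l ≠ r.2.2 → T.coeff r.1 r.2.1 l = 0)
    (hM : ∀ r ∈ M, T.coeff r.1 r.2.1 r.2.2 ≠ 0 ∧ ∀ i, i ≠ r.1 → T.coeff i r.2.1 r.2.2 = 0)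
    (φ : Fm) (s : Gen → Bool) (h : φ.Exact U L M s = true) :
    φ.eval k T.Alg = coord T s := by
  rw [Exact, allGen_iff] at h
  simp only [Bool.and_eq_true, beq_iff_eq] at h
  obtain ⟨hl, hu⟩ := comb_le_eval_le hU hL hM φ
  rw [← (funext fun l => (h l).1 : s = _)] at hl
  rw [← (funext fun l => (h l).2 : s = _)] at hu
  exact le_antisymm hu hl

theorem Name.eval_eq (a : Name k) (φ : Fm) (s : Gen → Bool)
    (h : φ.Exact a.toRat.table.pat a.toRat.low [] s = true) :
    φ.eval k a.Alg = coord a.table s := by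
  rw [← a.pat_toRat, ← a.low_toRat] at h
  exact Fm.eval_eq_of_exact (fun i j l hc => rel_pat_of_coeff_ne_zero hc) a.coeff_low (by simp)
    φ s h

/-- The number of basis elements in a coordinate subspace. -/
def cardGen (s : Gen → Bool) : ℕ :=
  (if s .n1 then 1 else 0) + (if s .n2 then 1 else 0) + (if s .n3 then 1 else 0) +
    (if s .n4 then 1 else 0) + (if s .n5 then 1 else 0)

theorem finrank_coord_eq (T : Table k) (s : Gen → Bool) :
    Module.finrank k (coord T s) = cardGen s := by
  rw [finrank_coord, Finset.card_filter, sum_gen]; rfl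

/-- The combinatorial values of the square, the cube and the fourth power. -/
def Name.powers (a : Name ℚ) : (Gen → Bool) × (Gen → Bool) × (Gen → Bool) :=
  (Fm.sq.comb a.table.pat a.low [] true, Fm.cube.comb a.table.pat a.low [] true,
    Fm.fourth.comb a.table.pat a.low [] true)

theorem Name.powers_check (a : Name k) :
    (Fm.sq.Exact a.toRat.table.pat a.toRat.low [] a.toRat.powers.1 &&
     Fm.cube.Exact a.toRat.table.pat a.toRat.low [] a.toRat.powers.2.1 &&
     Fm.fourth.Exact a.toRat.table.pat a.toRat.low [] a.toRat.powers.2.2) = true ∧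
    (cardGen a.toRat.powers.1, cardGen a.toRat.powers.2.1, cardGen a.toRat.powers.2.2) =
      a.toRat.sig := by
  cases a <;> simp only [Name.toRat] <;> decide +kernel

theorem Name.eval_powers (a : Name k) :
    Fm.sq.eval k a.Alg = coord a.table a.toRat.powers.1 ∧
    Fm.cube.eval k a.Alg = coord a.table a.toRat.powers.2.1 ∧
    Fm.fourth.eval k a.Alg = coord a.table a.toRat.powers.2.2 := by
  have h := a.powers_check.1
  simp only [Bool.and_eq_true] at h
  exact ⟨a.eval_eq _ _ h.1.1, a.eval_eq _ _ h.1.2, a.eval_eq _ _ h.2⟩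

theorem Name.sig_toRat (a : Name k) : a.toRat.sig = a.sig := by cases a <;> rfl

theorem Name.finrank_powers (a : Name k) :
    (Module.finrank k (Fm.sq.eval k a.Alg), Module.finrank k (Fm.cube.eval k a.Alg),
      Module.finrank k (Fm.fourth.eval k a.Alg)) = a.sig := by
  obtain ⟨e1, e2, e3⟩ := a.eval_powers
  rw [e1, e2, e3]
  simp only [finrank_coord_eq]
  rw [a.powers_check.2, a.sig_toRat]

theorem Name.sig_eq {a b : Name k} (h : Isomorphic k a.Alg b.Alg) : a.sig = b.sig := by
  obtain ⟨f, hf⟩ := h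
  rw [← a.finrank_powers, ← b.finrank_powers]
  simp only [Fm.finrank_eval f hf]

/-! ### Filtrations, nilpotency and the Jordan identity -/

/-- The span of the basis elements of weight at least `n`. -/
def filt (T : Table k) (w : Gen → ℕ) (n : ℕ) : Submodule k T.Alg where
  carrier := {x | ∀ l, w l < n → x l = 0}
  add_mem' := fun ha hb l hl => by rw [add_coord, ha l hl, hb l hl, add_zero]
  zero_mem' := fun _ _ => rfl
  smul_mem' := fun c x hx l hl => by rw [smul_coord, hx l hl, mul_zero]

theorem mul_mem_filt {T : Table k} {w : Gen → ℕ} (hw : ∀ r ∈ T.pat, w r.1 + w r.2.1 ≤ w r.2.2)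
    {m n : ℕ} {x y : T.Alg} (hx : x ∈ filt T w m) (hy : y ∈ filt T w n) :
    x * y ∈ filt T w (m + n) := by
  intro l hl
  rw [Table.Alg.mul_apply]
  refine Finset.sum_eq_zero fun i _ => Finset.sum_eq_zero fun j _ => ?_
  by_cases hc : T.coeff i j l = 0
  · rw [hc, mul_zero]
  have hr := rel_pat_of_coeff_ne_zero hc
  simp only [Pat.rel, List.any_eq_true, Bool.or_eq_true, beq_iff_eq] at hr
  have hij : w i + w j ≤ w l := by
    obtain ⟨r, hr, rfl | rfl⟩ := hr
    · exact hw _ hr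
    · rw [add_comm]; exact hw _ hr
  by_cases hi : w i < m
  · rw [hx i hi, zero_mul, zero_mul]
  · rw [hy j (by omega), mul_zero, zero_mul]

theorem filt_eq_top {T : Table k} {w : Gen → ℕ} (h1 : ∀ l, 1 ≤ w l) (x : T.Alg) :
    x ∈ filt T w 1 := fun l hl => absurd hl (by have := h1 l; omega)

theorem power_le_filt {T : Table k} {w : Gen → ℕ} (h1 : ∀ l, 1 ≤ w l)
    (hw : ∀ r ∈ T.pat, w r.1 + w r.2.1 ≤ w r.2.2) (n : ℕ) : power k T.Alg n ≤ filt T w n := by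
  induction n using Nat.strong_induction_on with
  | _ n ih =>
    match n with
    | 0 => exact fun x _ l hl => absurd hl (Nat.not_lt_zero _)
    | 1 => exact fun x _ => filt_eq_top h1 x
    | n + 2 =>
      rw [power]
      refine iSup_le fun i => Submodule.span_le.2 ?_
      rintro _ ⟨x, hx, y, hy, rfl⟩
      have := mul_mem_filt hw (ih _ (by omega) hx) (ih _ (by omega) hy)
      rwa [show n + 1 - (i : ℕ) + (i + 1) = n + 2 by omega] at this

theorem eq_zero_of_mem_filt {T : Table k} {w : Gen → ℕ} {n : ℕ} (h : ∀ l, w l < n) {x : T.Alg}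
    (hx : x ∈ filt T w n) : x = 0 := alg_ext fun l => hx l (h l)

/-- The largest `n ≤ 5` such that the basis element lies in the `n`th power. -/
def Name.weight (a : Name ℚ) (l : Gen) : ℕ :=
  1 + (a.powers.1 l).toNat + (a.powers.2.1 l).toNat + (a.powers.2.2 l).toNat +
    ((Fm.mul .fourth .top).comb a.table.pat a.low [] true l).toNat

theorem Name.weight_check (a : Name k) :
    (∀ r ∈ a.toRat.table.pat,
      a.toRat.weight r.1 + a.toRat.weight r.2.1 ≤ a.toRat.weight r.2.2) ∧
    (a.toRat.sig.2.2 = 0 → ∀ l, a.toRat.weight l < 4) ∧ ∀ l, a.toRat.weight l < 6 := by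
  cases a <;> simp only [Name.toRat] <;> decide +kernel

theorem Name.isNilpotentAlg (a : Name k) : IsNilpotentAlg k a.Alg := by
  obtain ⟨h, -, h6⟩ := a.weight_check
  rw [← a.pat_toRat] at h
  refine ⟨6, by norm_num, (Submodule.eq_bot_iff _).2 fun x hx => ?_⟩
  refine eq_zero_of_mem_filt h6 (power_le_filt (fun l => ?_) h 6 hx)
  unfold Name.weight; omega

theorem Name.isCommJordan (a : Name k) : IsCommJordan a.Alg := by
  obtain ⟨h, h4, -⟩ := a.weight_check
  rw [← a.pat_toRat] at h
  rw [a.sig_toRat] at h4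
  by_cases hs : a.sig.2.2 = 0
  · have h1 : ∀ x : a.Alg, x ∈ filt a.table a.toRat.weight 1 :=
      filt_eq_top fun l => by unfold Name.weight; omega
    refine ⟨fun x y => ?_⟩
    rw [eq_zero_of_mem_filt (h4 hs)
        (mul_mem_filt (m := 2) (n := 2) h (mul_mem_filt h (h1 x) (h1 y))
          (mul_mem_filt h (h1 x) (h1 x))),
      eq_zero_of_mem_filt (h4 hs)
        (mul_mem_filt (m := 1) (n := 3) h (h1 x) (mul_mem_filt (m := 1) (n := 2) h (h1 y)
          (mul_mem_filt h (h1 x) (h1 x))))]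
  · refine ⟨fun x y => alg_ext fun l => ?_⟩
    cases a <;> try exact absurd rfl hs
    all_goals
      cases l <;> simp [mul_apply_rows, Name.table, rowMul] <;> try ring

theorem Name.isAssociative_of_isE {a : Name k} (h : a.IsE) : IsAssociative a.Alg := by
  intro x y z
  refine alg_ext fun l => ?_
  cases a <;> try exact h.elim
  all_goals
    cases l <;> simp [mul_apply_rows, Name.table, rowMul] <;> try ring

open Gen in
/-- Basis elements `i`, `j`, `m` and a coordinate `l` in which `(i * j) * m` and `i * (j * m)`
differ, for the algebras that are not associative. -/
def Name.witness : Name k → Gen × Gen × Gen × Gen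
  | .J1 | .J2 | .J3 => (n1, n1, n4, n3)
  | .J4 => (n1, n4, n4, n3)
  | .J5 | .J6 => (n1, n1, n3, n5)
  | .J7 | .J8 | .J9 => (n1, n2, n4, n5)
  | .J15 _ => (n1, n1, n4, n5)
  | .J19 | .J20 | .J21 => (n1, n2, n3, n5)
  | .J22 => (n1, n3, n3, n5)
  | .J23 _ | .J26 _ => (n1, n2, n2, n5)
  | .J28 | .J29 | .J30 | .J31 | .J32 | .J33 => (n1, n1, n3, n4)
  | .J34 | .J35 | .J36 | .J37 | .J38 | .J39 | .J40 | .J41 _ => (n1, n1, n2, n4)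
  | _ => (n1, n1, n2, n5)

theorem Name.isE_of_isAssociative (h3 : (3 : k) ≠ 0) {a : Name k} (h : IsAssociative a.Alg) :
    a.IsE ∨ a = .J24 1 := by
  have hw : ∀ x y z : a.Alg, ((x * y) * z) a.witness.2.2.2 = (x * (y * z)) a.witness.2.2.2 :=
    fun x y z => congrFun (h x y z) _
  have hx : ∃ x y z : a.Alg, x = bas _ a.witness.1 ∧ y = bas _ a.witness.2.1 ∧
      z = bas _ a.witness.2.2.1 := ⟨_, _, _, rfl, rfl, rfl⟩
  obtain ⟨x, y, z, hx, hy, hz⟩ := hx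
  replace hw := hw x y z
  cases a <;> try exact Or.inl trivial
  all_goals
    simp only [Name.witness] at hx hy hz hw
    simp [mul_apply_rows, Name.table, rowMul] at hw
    simp [hx, hy, hz, bas_apply] at hw
  case J25 => exact absurd (by linear_combination -hw) h3
  case J24 => exact Or.inr (by rw [hw])

theorem Name.isAssociative_iff (h3 : (3 : k) ≠ 0) (a : Name k) :
    IsAssociative a.Alg ↔ (a.IsE ∨ a = .J24 1) := by
  refine ⟨Name.isE_of_isAssociative h3, ?_⟩
  rintro (h | rfl)
  · exact Name.isAssociative_of_isE h
  · intro x y z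
    refine alg_ext fun l => ?_
    cases l <;> simp [mul_apply_rows, Name.table, rowMul] <;> try ring

/-! ### Isomorphisms -/

theorem Isomorphic.refl (A : Type*) [NonUnitalNonAssocRing A] [Module k A] : Isomorphic k A A :=
  ⟨LinearEquiv.refl k A, fun _ _ => rfl⟩

theorem Isomorphic.symm {A B : Type*} [NonUnitalNonAssocRing A] [Module k A]
    [NonUnitalNonAssocRing B] [Module k B] (h : Isomorphic k A B) : Isomorphic k B A := by
  obtain ⟨f, hf⟩ := h
  exact ⟨f.symm, fun x y => f.injective (by simp [hf])⟩

theorem Isomorphic.trans {A B C : Type*} [NonUnitalNonAssocRing A] [Module k A]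
    [NonUnitalNonAssocRing B] [Module k B] [NonUnitalNonAssocRing C] [Module k C]
    (h : Isomorphic k A B) (h' : Isomorphic k B C) : Isomorphic k A C := by
  obtain ⟨f, hf⟩ := h
  obtain ⟨g, hg⟩ := h'
  exact ⟨f.trans g, fun x y => by simp [hf, hg]⟩

/-- The linear map given by a list of matrix entries: a triple `(i, l, c)` says that the image of
the basis element `i` contains the summand `c • l`. -/
def lin (P : List (Gen × Gen × k)) (x : Gen → k) (l : Gen) : k :=
  (P.map fun r => if r.2.1 = l then r.2.2 * x r.1 else 0).sum

theorem lin_add (P : List (Gen × Gen × k)) (x y : Gen → k) :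
    lin P (fun l => x l + y l) = fun l => lin P x l + lin P y l := by
  funext l
  unfold lin
  induction P with
  | nil => simp
  | cons r P ih =>
    simp only [List.map_cons, List.sum_cons, ih]
    split_ifs <;> ring

theorem lin_smul (P : List (Gen × Gen × k)) (c : k) (x : Gen → k) :
    lin P (fun l => c * x l) = fun l => c * lin P x l := by
  funext l
  unfold lin
  induction P with
  | nil => simp
  | cons r P ih =>
    simp only [List.map_cons, List.sum_cons, ih]
    split_ifs <;> ring

/-- A multiplicative linear map with a right inverse is an isomorphism. -/
theorem isomorphic_of_lin {S T : Table k} (P Q : List (Gen × Gen × k))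
    (hPQ : ∀ (x : Gen → k) (l : Gen), lin P (lin Q x) l = x l)
    (hP : ∀ (x y : S.Alg) (l : Gen),
      lin P (x * y) l = ((show T.Alg from lin P x) * (show T.Alg from lin P y)) l) :
    Isomorphic k S.Alg T.Alg := by
  let F : (Gen → k) →ₗ[k] (Gen → k) :=
    { toFun := lin P
      map_add' := lin_add P
      map_smul' := lin_smul P }
  have hs : Function.Surjective F := fun y => ⟨lin Q y, funext (hPQ y)⟩
  have hi : Function.Injective F := LinearMap.injective_iff_surjective.2 hs
  let G : S.Alg →ₗ[k] T.Alg := F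
  exact ⟨LinearEquiv.ofBijective G ⟨hi, hs⟩, fun x y => alg_ext (hP x y)⟩

theorem isomorphic_of_lin_rows {S T : Table k} (P Q : List (Gen × Gen × k))
    (hPQ : ∀ (x : Gen → k) (l : Gen), lin P (lin Q x) l = x l)
    (hP : ∀ (x y : Gen → k) (l : Gen),
      lin P (fun m => (S.map (rowMul x y m)).sum) l = (T.map (rowMul (lin P x) (lin P y) l)).sum) :
    Isomorphic k S.Alg T.Alg := by
  refine isomorphic_of_lin P Q hPQ fun x y l => ?_
  rw [mul_apply_rows, show (x * y : S.Alg) = fun m => (S.map (rowMul x y m)).sum from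
    funext (mul_apply_rows S x y)]
  exact hP x y l

/-- An algebra with two generators `n1`, `n2` such that `n1 * n2 = 0`. -/
def tabR (p q r s : k) : Table k :=
  [(.n1, .n1, .n3, 1), (.n2, .n2, .n4, 1), (.n1, .n3, .n5, p), (.n1, .n4, .n5, q),
    (.n2, .n3, .n5, r), (.n2, .n4, .n5, s)]

/-- An algebra with two generators `n1`, `n2` such that `n2 * n2` is a multiple of `n5`. -/
def tabS (p q r s t : k) : Table k :=
  [(.n1, .n1, .n3, 1), (.n1, .n2, .n4, 1), (.n2, .n2, .n5, t), (.n1, .n3, .n5, p),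
    (.n1, .n4, .n5, q), (.n2, .n3, .n5, r), (.n2, .n4, .n5, s)]

/-- The list of matrix entries of a permutation of the basis. -/
def perm (a b c d e : Gen) : List (Gen × Gen × k) :=
  [(.n1, a, 1), (.n2, b, 1), (.n3, c, 1), (.n4, d, 1), (.n5, e, 1)]

section

open Gen Name

theorem iso_E3 : Isomorphic k (Name.Alg (k := k) .E3) (tabR (k := k) 1 0 0 1).Alg := by
  refine isomorphic_of_lin_rows (perm n1 n3 n5 n2 n4) (perm n1 n4 n2 n5 n3) ?_ ?_
  · intro x l; cases l <;> simp [lin, perm]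
  · intro x y l; cases l <;> simp [lin, perm, rowMul, Name.table, tabR]

theorem iso_E6 : Isomorphic k (Name.Alg (k := k) .E6) (tabR (k := k) 1 0 0 0).Alg := by
  refine isomorphic_of_lin_rows (perm n1 n3 n5 n2 n4) (perm n1 n4 n2 n5 n3) ?_ ?_
  · intro x l; cases l <;> simp [lin, perm]
  · intro x y l; cases l <;> simp [lin, perm, rowMul, Name.table, tabR]

theorem iso_J26 (δ : k) : Isomorphic k (Name.Alg (.J26 δ)) (tabR 1 1 0 δ).Alg := by
  refine isomorphic_of_lin_rows (perm n1 n2 n3 n4 n5) (perm n1 n2 n3 n4 n5) ?_ ?_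
  · intro x l; cases l <;> simp [lin, perm]
  · intro x y l; cases l <;> simp [lin, perm, rowMul, Name.table, tabR]; ring

theorem iso_J27 (ε φ : k) : Isomorphic k (Name.Alg (.J27 ε φ)) (tabR φ 1 1 ε).Alg := by
  refine isomorphic_of_lin_rows (perm n1 n2 n3 n4 n5) (perm n1 n2 n3 n4 n5) ?_ ?_
  · intro x l; cases l <;> simp [lin, perm]
  · intro x y l; cases l <;> simp [lin, perm, rowMul, Name.table, tabR]; ring

theorem iso_J28 : Isomorphic k (Name.Alg (k := k) .J28) (tabR (k := k) 0 0 1 0).Alg := by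
  refine isomorphic_of_lin_rows (perm n1 n3 n2 n5 n4) (perm n1 n3 n2 n5 n4) ?_ ?_
  · intro x l; cases l <;> simp [lin, perm]
  · intro x y l; cases l <;> simp [lin, perm, rowMul, Name.table, tabR]; ring

theorem iso_J30 : Isomorphic k (Name.Alg (k := k) .J30) (tabR (k := k) 1 0 1 0).Alg := by
  refine isomorphic_of_lin_rows
    [(n1, n2, 1), (n1, n1, -1), (n2, n3, 1), (n2, n4, 1), (n3, n2, 1), (n4, n5, 1), (n5, n4, 1)]
    [(n1, n3, 1), (n1, n1, -1), (n2, n3, 1), (n3, n2, 1), (n3, n5, -1), (n4, n5, 1), (n5, n4, 1)]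
    ?_ ?_
  · intro x l; cases l <;> simp [lin]
  · intro x y l; cases l <;> simp [lin, rowMul, Name.table, tabR] <;> ring

theorem iso_J23 (β : k) : Isomorphic k (Name.Alg (.J23 β)) (tabS 1 0 β 1 0).Alg := by
  refine isomorphic_of_lin_rows (perm n1 n2 n3 n4 n5) (perm n1 n2 n3 n4 n5) ?_ ?_
  · intro x l; cases l <;> simp [lin, perm]
  · intro x y l; cases l <;> simp [lin, perm, rowMul, Name.table, tabS]; ring

theorem iso_J24 (γ : k) : Isomorphic k (Name.Alg (.J24 γ)) (tabS 0 γ 1 0 0).Alg := by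
  refine isomorphic_of_lin_rows (perm n1 n2 n3 n4 n5) (perm n1 n2 n3 n4 n5) ?_ ?_
  · intro x l; cases l <;> simp [lin, perm]
  · intro x y l; cases l <;> simp [lin, perm, rowMul, Name.table, tabS]; ring

theorem iso_J25 : Isomorphic k (Name.Alg (k := k) .J25) (tabS (k := k) 1 1 (-2) 0 0).Alg := by
  refine isomorphic_of_lin_rows (perm n1 n2 n3 n4 n5) (perm n1 n2 n3 n4 n5) ?_ ?_
  · intro x l; cases l <;> simp [lin, perm]
  · intro x y l; cases l <;> simp [lin, perm, rowMul, Name.table, tabS]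

theorem iso_J34 : Isomorphic k (Name.Alg (k := k) .J34) (tabS (k := k) 0 1 0 0 0).Alg := by
  refine isomorphic_of_lin_rows (perm n1 n2 n4 n5 n3) (perm n1 n2 n5 n3 n4) ?_ ?_
  · intro x l; cases l <;> simp [lin, perm]
  · intro x y l; cases l <;> simp [lin, perm, rowMul, Name.table, tabS]

theorem iso_J35 : Isomorphic k (Name.Alg (k := k) .J35) (tabS (k := k) 0 0 0 1 0).Alg := by
  refine isomorphic_of_lin_rows (perm n2 n1 n4 n5 n3) (perm n2 n1 n5 n3 n4) ?_ ?_
  · intro x l; cases l <;> simp [lin, perm]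
  · intro x y l; cases l <;> simp [lin, perm, rowMul, Name.table, tabS]; ring

theorem iso_J39 : Isomorphic k (Name.Alg (k := k) .J39) (tabS (k := k) 0 1 0 0 1).Alg := by
  refine isomorphic_of_lin_rows (perm n1 n2 n4 n5 n3) (perm n1 n2 n5 n3 n4) ?_ ?_
  · intro x l; cases l <;> simp [lin, perm]
  · intro x y l; cases l <;> simp [lin, perm, rowMul, Name.table, tabS]

theorem iso_J41 : Isomorphic k (Name.Alg (k := k) (.J41 0)) (tabS (k := k) 0 1 0 1 0).Alg := by
  refine isomorphic_of_lin_rows (perm n1 n2 n4 n5 n3) (perm n1 n2 n5 n3 n4) ?_ ?_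
  · intro x l; cases l <;> simp [lin, perm]
  · intro x y l; cases l <;> simp [lin, perm, rowMul, Name.table, tabS]

theorem iso_E8 : Isomorphic k (Name.Alg (k := k) .E8) (tabS (k := k) 1 0 0 0 1).Alg := by
  refine isomorphic_of_lin_rows (perm n1 n2 n3 n5 n4) (perm n1 n2 n3 n5 n4) ?_ ?_
  · intro x l; cases l <;> simp [lin, perm]
  · intro x y l; cases l <;> simp [lin, perm, rowMul, Name.table, tabS]

theorem iso_E10 : Isomorphic k (Name.Alg (k := k) .E10) (tabS (k := k) 1 0 0 0 0).Alg := by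
  refine isomorphic_of_lin_rows (perm n1 n2 n3 n5 n4) (perm n1 n2 n3 n5 n4) ?_ ?_
  · intro x l; cases l <;> simp [lin, perm]
  · intro x y l; cases l <;> simp [lin, perm, rowMul, Name.table, tabS]

/-! ### The coincidences -/

theorem iso_J23_neg (β : k) : Isomorphic k (Name.Alg (.J23 β)) (Name.Alg (.J23 (-β))) := by
  refine isomorphic_of_lin_rows
    [(n1, n1, 1), (n2, n2, -1), (n3, n3, 1), (n4, n4, -1), (n5, n5, 1)]
    [(n1, n1, 1), (n2, n2, -1), (n3, n3, 1), (n4, n4, -1), (n5, n5, 1)] ?_ ?_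
  · intro x l; cases l <;> simp [lin]
  · intro x y l; cases l <;> simp [lin, rowMul, Name.table] <;> ring

theorem iso_J26_neg (δ : k) : Isomorphic k (Name.Alg (.J26 δ)) (Name.Alg (.J26 (-δ))) := by
  refine isomorphic_of_lin_rows
    [(n1, n1, 1), (n2, n2, -1), (n3, n3, 1), (n4, n4, 1), (n5, n5, 1)]
    [(n1, n1, 1), (n2, n2, -1), (n3, n3, 1), (n4, n4, 1), (n5, n5, 1)] ?_ ?_
  · intro x l; cases l <;> simp [lin]
  · intro x y l; cases l <;> simp [lin, rowMul, Name.table] <;> ring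

theorem iso_J27_swap (ε φ : k) :
    Isomorphic k (Name.Alg (.J27 ε φ)) (Name.Alg (.J27 φ ε)) := by
  refine isomorphic_of_lin_rows (perm n2 n1 n4 n3 n5) (perm n2 n1 n4 n3 n5) ?_ ?_
  · intro x l; cases l <;> simp [lin, perm]
  · intro x y l; cases l <;> simp [lin, perm, rowMul, Name.table]; ring

theorem iso_J41_inv (l : k) (hl : l ≠ 0) :
    Isomorphic k (Name.Alg (.J41 l)) (Name.Alg (.J41 l⁻¹)) := by
  refine isomorphic_of_lin_rows
    [(n1, n2, 1), (n2, n1, 1), (n3, n3, 1), (n4, n4, 1), (n5, n5, l⁻¹)]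
    [(n1, n2, 1), (n2, n1, 1), (n3, n3, 1), (n4, n4, 1), (n5, n5, l)] ?_ ?_
  · intro x l; cases l <;> simp [lin, hl]
  · intro x y l; cases l <;> simp [lin, rowMul, Name.table] <;> field_simp <;> ring

theorem iso_J24_one : Isomorphic k (Name.Alg (k := k) (.J24 1)) (Name.Alg (k := k) .E4) := by
  refine isomorphic_of_lin_rows (perm n1 n2 n3 n4 n5) (perm n1 n2 n3 n4 n5) ?_ ?_
  · intro x l; cases l <;> simp [lin, perm]
  · intro x y l; cases l <;> simp [lin, perm, rowMul, Name.table]; ring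

theorem iso_J29 : Isomorphic k (Name.Alg (k := k) .J29) (Name.Alg (k := k) (.J24 0)) := by
  refine isomorphic_of_lin_rows (perm n1 n3 n2 n5 n4) (perm n1 n3 n2 n5 n4) ?_ ?_
  · intro x l; cases l <;> simp [lin, perm]
  · intro x y l; cases l <;> simp [lin, perm, rowMul, Name.table]; ring

theorem iso_J37 (h2 : (2 : k) ≠ 0) :
    Isomorphic k (Name.Alg (k := k) .J37) (Name.Alg (k := k) (.J27 (-1) (-1))) := by
  refine Isomorphic.symm (isomorphic_of_lin_rows
    [(n1, n1, 1), (n1, n2, 1), (n2, n2, 1), (n2, n1, -1), (n3, n5, 2), (n3, n3, 2), (n4, n5, 2),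
      (n4, n3, -2), (n5, n4, -2)]
    [(n1, n1, 1 / 2), (n1, n2, -1 / 2), (n2, n1, 1 / 2), (n2, n2, 1 / 2), (n5, n3, 1 / (2 * 2)),
      (n5, n4, 1 / (2 * 2)), (n3, n3, 1 / (2 * 2)), (n3, n4, -1 / (2 * 2)), (n4, n5, -1 / 2)] ?_ ?_)
  · intro x l; cases l <;> simp [lin] <;> field_simp <;> ring
  · intro x y l; cases l <;> simp [lin, rowMul, Name.table] <;> ring

theorem iso_J41_one [IsAlgClosed k] (h2 : (2 : k) ≠ 0) :
    Isomorphic k (Name.Alg (k := k) (.J41 1)) (Name.Alg (k := k) (.J26 0)) := by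
  obtain ⟨i, hi⟩ := IsAlgClosed.exists_pow_nat_eq (-1 : k) (n := 2) (by norm_num)
  refine Isomorphic.symm (isomorphic_of_lin_rows
    [(n1, n1, 1), (n1, n2, 1), (n2, n1, i), (n2, n2, -i), (n3, n5, 2), (n3, n3, 2), (n4, n5, -2),
      (n4, n3, 2), (n5, n4, 4)]
    [(n1, n1, 1 / 2), (n1, n2, -i / 2), (n2, n1, 1 / 2), (n2, n2, i / 2), (n5, n3, 1 / (2 * 2)),
      (n5, n4, -1 / (2 * 2)), (n3, n3, 1 / (2 * 2)), (n3, n4, 1 / (2 * 2)), (n4, n5, 1 / (2 * 2))]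
    ?_ ?_)
  · intro x l
    cases l <;> simp [lin] <;> field_simp <;> (try simp only [hi]) <;> ring
  · intro x y l
    cases l <;> simp [lin, rowMul, Name.table]
    case n5 => linear_combination (-(x n2 * y n2 * 2)) * hi
    case n3 => linear_combination (2 * x n2 * y n2) * hi
    all_goals ring

theorem iso_J41_J27 (h2 : (2 : k) ≠ 0) (l s ε : k) (h0 : l ≠ 0) (h1 : l ≠ 1) (hs : s ^ 2 = l)
    (hε : ε = -((-1 + s) ^ 2 / (1 + s) ^ 2)) :
    Isomorphic k (Name.Alg (.J41 l)) (Name.Alg (.J27 ε ε⁻¹)) := by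
  have hs0 : s ≠ 0 := by rintro rfl; exact h0 (by rw [← hs]; ring)
  have ha : 1 + s ≠ 0 := fun h => h1 (by linear_combination (s - 1) * h - hs)
  have hb : 1 - s ≠ 0 := fun h => h1 (by linear_combination (-s - 1) * h - hs)
  have hε1 : ε = -((1 - s) ^ 2 / (1 + s) ^ 2) := by rw [hε]; congr 2; ring
  have hε2 : ε⁻¹ = -((1 + s) ^ 2 / (1 - s) ^ 2) := by rw [hε1, inv_neg, inv_div]
  rw [hε2, hε1]
  subst hs
  set a := 1 + s with hA
  set b := 1 - s with hB
  refine Isomorphic.symm (isomorphic_of_lin_rows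
    [(n1, n1, a * s), (n1, n2, a), (n2, n1, b * s), (n2, n2, -b), (n3, n5, 2 * s ^ 2 * a ^ 2),
      (n3, n3, 2 * s * a ^ 2), (n4, n5, 2 * s ^ 2 * b ^ 2), (n4, n3, -(2 * s * b ^ 2)),
      (n5, n4, -(2 * s * a ^ 2 * b ^ 2))]
    [(n1, n1, 1 / (2 * s * a)), (n1, n2, 1 / (2 * s * b)), (n2, n1, 1 / (2 * a)),
      (n2, n2, -1 / (2 * b)), (n5, n3, 1 / (2 * 2 * s ^ 2 * a ^ 2)),
      (n5, n4, 1 / (2 * 2 * s ^ 2 * b ^ 2)), (n3, n3, 1 / (2 * 2 * s * a ^ 2)),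
      (n3, n4, -1 / (2 * 2 * s * b ^ 2)), (n4, n5, -1 / (2 * s * a ^ 2 * b ^ 2))] ?_ ?_)
  · intro x l; cases l <;> simp [lin] <;> field_simp <;> ring
  · intro x y l
    cases l <;> simp [lin, rowMul, Name.table] <;> field_simp <;> (try simp only [hA, hB]) <;> ring

theorem isomorphic_of_coincide [IsAlgClosed k] (h2 : (2 : k) ≠ 0) {a b : Name k}
    (h : Coincide a b) : Isomorphic k a.Alg b.Alg := by
  cases h with
  | j23 β => exact iso_J23_neg β
  | j26 δ => exact iso_J26_neg δ
  | j27 ε φ => exact iso_J27_swap ε φ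
  | j41 l hl => exact iso_J41_inv l hl
  | j24_one => exact iso_J24_one
  | j29 => exact iso_J29
  | j37 => exact iso_J37 h2
  | j41_j27 l s ε h0 h1 hs hε => exact iso_J41_J27 h2 l s ε h0 h1 hs hε
  | j41_one => exact iso_J41_one h2

end

theorem alg_eq_iff {T : Table k} {x y : T.Alg} :
    x = y ↔ x .n1 = y .n1 ∧ x .n2 = y .n2 ∧ x .n3 = y .n3 ∧ x .n4 = y .n4 ∧ x .n5 = y .n5 :=
  ⟨fun h => by simp [h], fun h => alg_ext (forall_gen.2 h)⟩

/-! ### Algebras with two generators and one-dimensional cube -/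

theorem tabR_mul (p q r s : k) (x y : (tabR p q r s).Alg) :
    (x * y) .n1 = 0 ∧ (x * y) .n2 = 0 ∧ (x * y) .n3 = x .n1 * y .n1 ∧
    (x * y) .n4 = x .n2 * y .n2 ∧
    (x * y) .n5 = p * (x .n1 * y .n3 + x .n3 * y .n1) + q * (x .n1 * y .n4 + x .n4 * y .n1) +
      r * (x .n2 * y .n3 + x .n3 * y .n2) + s * (x .n2 * y .n4 + x .n4 * y .n2) := by
  simp only [mul_apply_rows]
  simp [tabR, rowMul]
  ring

theorem tabS_mul (p q r s t : k) (x y : (tabS p q r s t).Alg) :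
    (x * y) .n1 = 0 ∧ (x * y) .n2 = 0 ∧ (x * y) .n3 = x .n1 * y .n1 ∧
    (x * y) .n4 = x .n1 * y .n2 + x .n2 * y .n1 ∧
    (x * y) .n5 = t * (x .n2 * y .n2) +
      p * (x .n1 * y .n3 + x .n3 * y .n1) + q * (x .n1 * y .n4 + x .n4 * y .n1) +
      r * (x .n2 * y .n3 + x .n3 * y .n2) + s * (x .n2 * y .n4 + x .n4 * y .n2) := by
  simp only [mul_apply_rows]
  simp [tabS, rowMul]
  ring

theorem exists_of_tabR_iso {p q r s : k} {B : Type*} [NonUnitalNonAssocCommRing B] [Module k B]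
    (h : Isomorphic k (tabR p q r s).Alg B) :
    ∃ u v w : B, u * v = 0 ∧ (u * u) * u = p • w ∧ (v * v) * u = q • w ∧ (u * u) * v = r • w ∧
      (v * v) * v = s • w ∧ u * u ≠ 0 ∧ v * v ≠ 0 ∧ w ≠ 0 := by
  obtain ⟨f, hf⟩ := h
  refine ⟨f (bas _ .n1), f (bas _ .n2), f (bas _ .n5), ?_⟩
  simp only [← hf, ← map_smul, ne_eq, EmbeddingLike.map_eq_zero_iff, f.injective.eq_iff,
    alg_eq_iff, tabR_mul, bas_apply, smul_coord]
  simp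

theorem exists_of_tabS_iso {p q r s t : k} {B : Type*} [NonUnitalNonAssocCommRing B] [Module k B]
    (h : Isomorphic k (tabS p q r s t).Alg B) :
    ∃ u v w : B, v * v = t • w ∧ (u * u) * u = p • w ∧ (u * v) * u = q • w ∧ (u * u) * v = r • w ∧
      (u * v) * v = s • w ∧ w ≠ 0 ∧ (∀ c : k, u * u ≠ c • w) ∧ ∀ c : k, u * v ≠ c • w := by
  obtain ⟨f, hf⟩ := h
  refine ⟨f (bas _ .n1), f (bas _ .n2), f (bas _ .n5), ?_⟩
  simp only [← hf, ← map_smul, ne_eq, EmbeddingLike.map_eq_zero_iff, f.injective.eq_iff,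
    alg_eq_iff, tabS_mul, bas_apply, smul_coord]
  simp

/-- In an algebra where triple products are multiples of `n5`, so is `w`, if some nonzero multiple
of `w` is a triple product. -/
theorem eq_smul_n5 {T : Table k} {w : T.Alg} {p q r s : k}
    (hne : p ≠ 0 ∨ q ≠ 0 ∨ r ≠ 0 ∨ s ≠ 0)
    (h : ∀ l, l ≠ .n5 → p * w l = 0 ∧ q * w l = 0 ∧ r * w l = 0 ∧ s * w l = 0) :
    w .n1 = 0 ∧ w .n2 = 0 ∧ w .n3 = 0 ∧ w .n4 = 0 := by
  have key : ∀ l, l ≠ .n5 → w l = 0 := fun l hl => by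
    obtain ⟨h1, h2, h3, h4⟩ := h l hl
    rcases hne with h | h | h | h
    · exact (mul_eq_zero.1 h1).resolve_left h
    · exact (mul_eq_zero.1 h2).resolve_left h
    · exact (mul_eq_zero.1 h3).resolve_left h
    · exact (mul_eq_zero.1 h4).resolve_left h
  exact ⟨key _ (by decide), key _ (by decide), key _ (by decide), key _ (by decide)⟩

theorem tabR_iso_tabR {p q r s p' q' r' s' : k} (hne : p ≠ 0 ∨ q ≠ 0 ∨ r ≠ 0 ∨ s ≠ 0)
    (h : Isomorphic k (tabR p q r s).Alg (tabR p' q' r' s').Alg) :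
    ∃ a b e : k, a ≠ 0 ∧ b ≠ 0 ∧ e ≠ 0 ∧
      ((p' * a ^ 3 = p * e ∧ q' * (a * b ^ 2) = q * e ∧ r' * (a ^ 2 * b) = r * e ∧
          s' * b ^ 3 = s * e) ∨
        (s' * a ^ 3 = p * e ∧ r' * (a * b ^ 2) = q * e ∧ q' * (a ^ 2 * b) = r * e ∧
          p' * b ^ 3 = s * e)) := by
  obtain ⟨u, v, w, huv, hp, hq, hr, hs, hu, hv, hw⟩ := exists_of_tabR_iso h
  simp only [alg_eq_iff, tabR_mul, smul_coord] at huv hp hq hr hs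
  obtain ⟨-, -, h3, h4, -⟩ := huv
  obtain ⟨w1, w2, w3, w4⟩ : w .n1 = 0 ∧ w .n2 = 0 ∧ w .n3 = 0 ∧ w .n4 = 0 := by
    refine eq_smul_n5 hne fun l hl => ?_
    simp only [zero_mul] at hp hq hr hs
    cases l
    · exact ⟨hp.1.symm, hq.1.symm, hr.1.symm, hs.1.symm⟩
    · exact ⟨hp.2.1.symm, hq.2.1.symm, hr.2.1.symm, hs.2.1.symm⟩
    · exact ⟨hp.2.2.1.symm, hq.2.2.1.symm, hr.2.2.1.symm, hs.2.2.1.symm⟩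
    · exact ⟨hp.2.2.2.1.symm, hq.2.2.2.1.symm, hr.2.2.2.1.symm, hs.2.2.2.1.symm⟩
    · exact absurd rfl hl
  have he : w .n5 ≠ 0 := fun h => hw (eq_zero_iff.2 ⟨w1, w2, w3, w4, h⟩)
  have hu' : u .n1 ≠ 0 ∨ u .n2 ≠ 0 := by
    by_contra hc
    push Not at hc
    exact hu (eq_zero_iff.2 (by simp [tabR_mul, hc.1, hc.2]))
  have hv' : v .n1 ≠ 0 ∨ v .n2 ≠ 0 := by
    by_contra hc
    push Not at hc
    exact hv (eq_zero_iff.2 (by simp [tabR_mul, hc.1, hc.2]))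
  have hp5 := hp.2.2.2.2
  have hq5 := hq.2.2.2.2
  have hr5 := hr.2.2.2.2
  have hs5 := hs.2.2.2.2
  by_cases hu1 : u .n1 = 0
  · have hu2 := hu'.resolve_left (not_not.2 hu1)
    have hv2 : v .n2 = 0 := (mul_eq_zero.1 h4).resolve_left hu2
    have hv1 := hv'.resolve_right (not_not.2 hv2)
    refine ⟨u .n2, v .n1, w .n5, hu2, hv1, he, Or.inr ?_⟩
    simp only [hu1, hv2] at hp5 hq5 hr5 hs5
    exact ⟨by linear_combination hp5, by linear_combination hq5, by linear_combination hr5,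
      by linear_combination hs5⟩
  · have hv1 : v .n1 = 0 := (mul_eq_zero.1 h3).resolve_left hu1
    have hv2 := hv'.resolve_left (not_not.2 hv1)
    have hu2 : u .n2 = 0 := (mul_eq_zero.1 h4).resolve_right hv2
    refine ⟨u .n1, v .n2, w .n5, hu1, hv2, he, Or.inl ?_⟩
    simp only [hv1, hu2] at hp5 hq5 hr5 hs5
    exact ⟨by linear_combination hp5, by linear_combination hq5, by linear_combination hr5,
      by linear_combination hs5⟩

theorem tabS_iso_tabS {p q r s t p' q' r' s' t' : k} (hne : p ≠ 0 ∨ q ≠ 0 ∨ r ≠ 0 ∨ s ≠ 0)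
    (h : Isomorphic k (tabS p q r s t).Alg (tabS p' q' r' s' t').Alg) :
    ∃ a b c e : k, a ≠ 0 ∧ b ≠ 0 ∧ e ≠ 0 ∧
      a ^ 3 * p' + a ^ 2 * c * (2 * q' + r') + 2 * a * c ^ 2 * s' = p * e ∧
      a * b * (a * q' + c * s') = q * e ∧ b * (a ^ 2 * r' + 2 * a * c * s') = r * e ∧
      a * b ^ 2 * s' = s * e ∧ (r' = 0 → s' = 0 → b ^ 2 * t' = t * e) := by
  obtain ⟨u, v, w, hvv, hp, hq, hr, hs, hw, hu, huv⟩ := exists_of_tabS_iso h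
  simp only [alg_eq_iff, tabS_mul, smul_coord] at hvv hp hq hr hs
  obtain ⟨w1, w2, w3, w4⟩ : w .n1 = 0 ∧ w .n2 = 0 ∧ w .n3 = 0 ∧ w .n4 = 0 := by
    refine eq_smul_n5 hne fun l hl => ?_
    simp only [zero_mul, add_zero] at hp hq hr hs
    cases l
    · exact ⟨hp.1.symm, hq.1.symm, hr.1.symm, hs.1.symm⟩
    · exact ⟨hp.2.1.symm, hq.2.1.symm, hr.2.1.symm, hs.2.1.symm⟩
    · exact ⟨hp.2.2.1.symm, hq.2.2.1.symm, hr.2.2.1.symm, hs.2.2.1.symm⟩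
    · exact ⟨hp.2.2.2.1.symm, hq.2.2.2.1.symm, hr.2.2.2.1.symm, hs.2.2.2.1.symm⟩
    · exact absurd rfl hl
  have he : w .n5 ≠ 0 := fun h => hw (eq_zero_iff.2 ⟨w1, w2, w3, w4, h⟩)
  have hv1 : v .n1 = 0 := by
    have := hvv.2.2.1
    rw [w3, mul_zero] at this
    exact mul_self_eq_zero.1 this
  have hpar : ∀ x : (tabS p' q' r' s' t').Alg, x .n1 = 0 → x .n2 = 0 → x .n3 = 0 → x .n4 = 0 →
      x = (x .n5 / w .n5) • w := fun x x1 x2 x3 x4 => by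
    refine alg_ext (forall_gen.2 ?_)
    simp [x1, x2, x3, x4, w1, w2, w3, w4, he]
  have hu1 : u .n1 ≠ 0 := fun h0 => huv _ (hpar _ (by simp [tabS_mul]) (by simp [tabS_mul])
    (by simp [tabS_mul, h0]) (by simp [tabS_mul, h0, hv1]))
  have hv2 : v .n2 ≠ 0 := fun h0 => huv _ (hpar _ (by simp [tabS_mul]) (by simp [tabS_mul])
    (by simp [tabS_mul, hv1]) (by simp [tabS_mul, h0, hv1]))
  have hp5 := hp.2.2.2.2
  have hq5 := hq.2.2.2.2
  have hr5 := hr.2.2.2.2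
  have hs5 := hs.2.2.2.2
  have ht5 := hvv.2.2.2.2
  simp only [hv1] at hp5 hq5 hr5 hs5 ht5
  refine ⟨u .n1, v .n2, u .n2, w .n5, hu1, hv2, he, by linear_combination hp5,
    by linear_combination hq5, by linear_combination hr5, by linear_combination hs5, ?_⟩
  rintro rfl rfl
  linear_combination ht5

theorem not_tabS_iso_tabR {p q r s t p' q' r' s' : k} (hne : p ≠ 0 ∨ q ≠ 0 ∨ r ≠ 0 ∨ s ≠ 0) :
    ¬ Isomorphic k (tabS p q r s t).Alg (tabR p' q' r' s').Alg := by
  intro h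
  obtain ⟨u, v, w, hvv, hp, hq, hr, hs, hw, hu, huv⟩ := exists_of_tabS_iso h
  simp only [alg_eq_iff, tabR_mul, smul_coord] at hvv hp hq hr hs
  obtain ⟨w1, w2, w3, w4⟩ : w .n1 = 0 ∧ w .n2 = 0 ∧ w .n3 = 0 ∧ w .n4 = 0 := by
    refine eq_smul_n5 hne fun l hl => ?_
    simp only [zero_mul] at hp hq hr hs
    cases l
    · exact ⟨hp.1.symm, hq.1.symm, hr.1.symm, hs.1.symm⟩
    · exact ⟨hp.2.1.symm, hq.2.1.symm, hr.2.1.symm, hs.2.1.symm⟩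
    · exact ⟨hp.2.2.1.symm, hq.2.2.1.symm, hr.2.2.1.symm, hs.2.2.1.symm⟩
    · exact ⟨hp.2.2.2.1.symm, hq.2.2.2.1.symm, hr.2.2.2.1.symm, hs.2.2.2.1.symm⟩
    · exact absurd rfl hl
  have he : w .n5 ≠ 0 := fun h => hw (eq_zero_iff.2 ⟨w1, w2, w3, w4, h⟩)
  obtain ⟨-, -, h3, h4, -⟩ := hvv
  rw [w3, mul_zero, mul_self_eq_zero] at h3
  rw [w4, mul_zero, mul_self_eq_zero] at h4
  refine huv ((u * v) .n5 / w .n5) (alg_ext (forall_gen.2 ?_))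
  simp [tabR_mul, w1, w2, w3, w4, h3, h4, he]

/-- The listed algebras that are isomorphic to `tabR p q r s`. -/
inductive ParR : Name k → k → k → k → k → Prop
  | e3 : ParR .E3 1 0 0 1
  | e6 : ParR .E6 1 0 0 0
  | j26 (δ : k) : ParR (.J26 δ) 1 1 0 δ
  | j27 (ε φ : k) : ParR (.J27 ε φ) φ 1 1 ε
  | j28 : ParR .J28 0 0 1 0
  | j30 : ParR .J30 1 0 1 0

/-- The listed algebras that are isomorphic to `tabS p q r s t`. -/
inductive ParS : Name k → k → k → k → k → k → Prop
  | j23 (β : k) : ParS (.J23 β) 1 0 β 1 0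
  | j24 (γ : k) : ParS (.J24 γ) 0 γ 1 0 0
  | j25 : ParS .J25 1 1 (-2) 0 0
  | j34 : ParS .J34 0 1 0 0 0
  | j35 : ParS .J35 0 0 0 1 0
  | j39 : ParS .J39 0 1 0 0 1
  | j41 : ParS (.J41 0) 0 1 0 1 0
  | e8 : ParS .E8 1 0 0 0 1
  | e10 : ParS .E10 1 0 0 0 0

theorem ParR.iso {a : Name k} {p q r s : k} (h : ParR a p q r s) :
    Isomorphic k a.Alg (tabR p q r s).Alg := by
  cases h
  exacts [iso_E3, iso_E6, iso_J26 _, iso_J27 _ _, iso_J28, iso_J30]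

theorem ParS.iso {a : Name k} {p q r s t : k} (h : ParS a p q r s t) :
    Isomorphic k a.Alg (tabS p q r s t).Alg := by
  cases h
  exacts [iso_J23 _, iso_J24 _, iso_J25, iso_J34, iso_J35, iso_J39, iso_J41, iso_E8, iso_E10]

theorem ParR.ne_zero {a : Name k} {p q r s : k} (h : ParR a p q r s) :
    p ≠ 0 ∨ q ≠ 0 ∨ r ≠ 0 ∨ s ≠ 0 := by
  cases h <;> simp

theorem ParS.ne_zero {a : Name k} {p q r s t : k} (h : ParS a p q r s t) :
    p ≠ 0 ∨ q ≠ 0 ∨ r ≠ 0 ∨ s ≠ 0 := by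
  cases h <;> simp

/-- The coincidences within a family with the same normal form. -/
inductive Twist : Name k → Name k → Prop
  | refl (a : Name k) : Twist a a
  | j23 (β : k) : Twist (.J23 β) (.J23 (-β))
  | j26 (δ : k) : Twist (.J26 δ) (.J26 (-δ))
  | j27 (ε φ : k) : Twist (.J27 ε φ) (.J27 φ ε)

theorem ParR.twist {a a' : Name k} {p q r s p' q' r' s' : k} (h : ParR a p q r s)
    (h' : ParR a' p' q' r' s') (hi : Isomorphic k a.Alg a'.Alg) : Twist a a' := by
  obtain ⟨x, y, e, hx, hy, he, heq⟩ :=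
    tabR_iso_tabR h.ne_zero ((h.iso.symm.trans hi).trans h'.iso)
  cases h <;> cases h' <;> simp [hx, hy, he, he.symm] at heq <;> try exact Twist.refl _
  case j26.j26 =>
    obtain ⟨h1, h2, h3⟩ := heq
    have hxy : (y - x) * (y + x) = 0 := mul_left_cancel₀ hx (by linear_combination h2 - h1)
    rcases mul_eq_zero.1 hxy with h | h
    · obtain rfl : y = x := by linear_combination h
      have : s' = s := mul_right_cancel₀ he (by linear_combination h3 - s' * h1)
      rw [this]; exact Twist.refl _
    · obtain rfl : y = -x := by linear_combination h
      have : s' = -s := mul_right_cancel₀ he (by linear_combination -h3 - s' * h1)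
      rw [this]; exact Twist.j26 _
  case j27.j27 =>
    have hyx : x * y ^ 2 = e → x ^ 2 * y = e → y = x := fun h2 h3 =>
      mul_left_cancel₀ (mul_ne_zero hx hy) (by linear_combination h2 - h3)
    rcases heq with ⟨h1, h2, h3, h4⟩ | ⟨h1, h2, h3, h4⟩
    · obtain rfl := hyx h2 h3
      have e1 : p' = p := mul_right_cancel₀ he (by linear_combination h1 - p' * h2)
      have e2 : s' = s := mul_right_cancel₀ he (by linear_combination h4 - s' * h2)
      rw [e1, e2]; exact Twist.refl _
    · obtain rfl := hyx h2 h3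
      have e1 : s' = p := mul_right_cancel₀ he (by linear_combination h1 - s' * h2)
      have e2 : p' = s := mul_right_cancel₀ he (by linear_combination h4 - p' * h2)
      rw [e1, e2]; exact Twist.j27 _ _

theorem ParS.twist (h2 : (2 : k) ≠ 0) {a a' : Name k} {p q r s t p' q' r' s' t' : k}
    (h : ParS a p q r s t) (h' : ParS a' p' q' r' s' t') (hi : Isomorphic k a.Alg a'.Alg) :
    Twist a a' := by
  obtain ⟨x, y, c, e, hx, hy, he, heq⟩ :=
    tabS_iso_tabS h.ne_zero ((h.iso.symm.trans hi).trans h'.iso)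
  cases h <;> cases h' <;> simp [hx, hy, he, he.symm, h2] at heq <;> try exact Twist.refl _
  case j23.j23 =>
    obtain ⟨h1, rfl, h3, h4⟩ := heq
    have hxy : (y - x) * (y + x) = 0 := mul_left_cancel₀ hx (by linear_combination h4 - h1)
    rcases mul_eq_zero.1 hxy with h | h
    · obtain rfl : y = x := by linear_combination h
      have : r' = r := mul_right_cancel₀ he (by linear_combination h3 - r' * h4)
      rw [this]; exact Twist.refl _
    · obtain rfl : y = -x := by linear_combination h
      have : r' = -r := mul_right_cancel₀ he (by linear_combination -h3 - r' * h4)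
      rw [this]; exact Twist.j23 _
  case j23.j35 =>
    obtain ⟨h1, rfl, -⟩ := heq
    exact absurd (by linear_combination -h1) he
  case j23.j41 =>
    obtain ⟨h1, h3, -⟩ := heq
    exact absurd (by linear_combination 2 * x * c * h3 - h1) he
  case j24.j24 =>
    obtain ⟨-, h1, h3⟩ := heq
    have : q' = q := mul_right_cancel₀ he (by linear_combination h1 - q' * h3)
    rw [this]; exact Twist.refl _
  case j25.j24 =>
    obtain ⟨h1, h3, h4⟩ := heq
    have hq : 2 * q' + 1 = 0 := by
      refine (mul_eq_zero.1 (?_ : (y * x ^ 2) * (2 * q' + 1) = 0)).resolve_left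
        (mul_ne_zero hy (pow_ne_zero 2 hx))
      linear_combination 2 * h3 + h4
    rw [hq, mul_zero] at h1
    exact absurd h1.symm he
  case j35.j23 =>
    obtain ⟨h1, rfl, -⟩ := heq
    exact absurd (by linear_combination h1) (pow_ne_zero 3 hx)
  case j35.j41 =>
    obtain ⟨-, h1, rfl, -⟩ := heq
    exact absurd (by linear_combination h1) hx
  case j41.j23 =>
    obtain ⟨h1, -, h3, -⟩ := heq
    exact absurd (by linear_combination h1 - c * h3) (pow_ne_zero 3 hx)
  case j41.j35 =>
    obtain ⟨rfl, h1, -⟩ := heq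
    exact absurd (by linear_combination -h1) he

/-- A name together with its representative among the algebras with a normal form. -/
inductive Red : Name k → Name k → Prop
  | parR {a : Name k} {p q r s : k} (h : ParR a p q r s) : Red a a
  | parS {a : Name k} {p q r s t : k} (h : ParS a p q r s t) : Red a a
  | e4 : Red .E4 (.J24 1)
  | j29 : Red .J29 (.J24 0)
  | j37 : Red .J37 (.J27 (-1) (-1))
  | j41_one : Red (.J41 1) (.J26 0)
  | j41 (l s ε : k) (h0 : l ≠ 0) (h1 : l ≠ 1) (hs : s ^ 2 = l)
      (hε : ε = -((-1 + s) ^ 2 / (1 + s) ^ 2)) : Red (.J41 l) (.J27 ε ε⁻¹)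

theorem Red.iso [IsAlgClosed k] (h2 : (2 : k) ≠ 0) {a c : Name k} (h : Red a c) :
    Isomorphic k a.Alg c.Alg := by
  cases h
  case parR | parS => exact Isomorphic.refl _
  case e4 => exact iso_J24_one.symm
  case j29 => exact iso_J29
  case j37 => exact iso_J37 h2
  case j41_one => exact iso_J41_one h2
  case j41 l s ε h0 h1 hs hε => exact iso_J41_J27 h2 l s ε h0 h1 hs hε

theorem Red.par {a c : Name k} (h : Red a c) :
    (∃ p q r s, ParR c p q r s) ∨ ∃ p q r s t, ParS c p q r s t := by
  cases h
  case parR h => exact Or.inl ⟨_, _, _, _, h⟩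
  case parS h => exact Or.inr ⟨_, _, _, _, _, h⟩
  case e4 | j29 => exact Or.inr ⟨_, _, _, _, _, ParS.j24 _⟩
  case j37 | j41 => exact Or.inl ⟨_, _, _, _, ParR.j27 _ _⟩
  case j41_one => exact Or.inl ⟨_, _, _, _, ParR.j26 _⟩

theorem Red.twist [IsAlgClosed k] (h2 : (2 : k) ≠ 0) {a b c d : Name k} (ha : Red a c)
    (hb : Red b d) (hi : Isomorphic k a.Alg b.Alg) : Twist c d := by
  have hcd := ((ha.iso h2).symm.trans hi).trans (hb.iso h2)
  rcases ha.par with ⟨_, _, _, _, hc⟩ | ⟨_, _, _, _, _, hc⟩ <;>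
    rcases hb.par with ⟨_, _, _, _, hd⟩ | ⟨_, _, _, _, _, hd⟩
  · exact hc.twist hd hcd
  · exact absurd ((hd.iso.symm.trans hcd.symm).trans hc.iso) (not_tabS_iso_tabR hd.ne_zero)
  · exact absurd ((hc.iso.symm.trans hcd).trans hd.iso) (not_tabS_iso_tabR hc.ne_zero)
  · exact hc.twist h2 hd hcd

theorem exists_red [IsAlgClosed k] {a : Name k} (h : a.sig = (3, 1, 0)) : ∃ c, Red a c := by
  cases a <;> try (simp [Name.sig] at h; done)
  case J41 l =>
    by_cases h0 : l = 0
    · subst h0; exact ⟨_, Red.parS ParS.j41⟩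
    by_cases h1 : l = 1
    · subst h1; exact ⟨_, Red.j41_one⟩
    obtain ⟨s, hs⟩ := IsAlgClosed.exists_pow_nat_eq l (n := 2) (by norm_num)
    exact ⟨_, Red.j41 l s _ h0 h1 hs rfl⟩
  case E4 => exact ⟨_, Red.e4⟩
  case J29 => exact ⟨_, Red.j29⟩
  case J37 => exact ⟨_, Red.j37⟩
  all_goals
    first
    | exact ⟨_, Red.parR (by constructor)⟩
    | exact ⟨_, Red.parS (by constructor)⟩

/-- Two values of `λ` with the same parameter `ε` in `J27`. -/
theorem eq_or_inv_of_same (h2 : (2 : k) ≠ 0) {l s l' s' : k} (h0 : l ≠ 0) (h1 : l ≠ 1)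
    (hs : s ^ 2 = l) (h1' : l' ≠ 1) (hs' : s' ^ 2 = l')
    (h : (-1 + s) ^ 2 / (1 + s) ^ 2 = (-1 + s') ^ 2 / (1 + s') ^ 2) : l' = l ∨ l' = l⁻¹ := by
  have ha : 1 + s ≠ 0 := fun h => h1 (by linear_combination (s - 1) * h - hs)
  have ha' : 1 + s' ≠ 0 := fun h => h1' (by linear_combination (s' - 1) * h - hs')
  rw [div_eq_div_iff (pow_ne_zero 2 ha) (pow_ne_zero 2 ha')] at h
  have : (2 * 2) * ((s - s') * (s * s' - 1)) = 0 := by linear_combination h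
  rcases mul_eq_zero.1 ((mul_eq_zero.1 this).resolve_left (mul_ne_zero h2 h2)) with e | e
  · left; rw [← hs, ← hs', sub_eq_zero.1 e]
  · right
    rw [← hs] at h0 ⊢
    rw [← mul_eq_one_iff_eq_inv₀ h0, ← hs']
    linear_combination (s * s' + 1) * e

theorem inv_param (s : k) :
    (-((-1 + s) ^ 2 / (1 + s) ^ 2))⁻¹ = -((-1 + -s) ^ 2 / (1 + -s) ^ 2) := by
  rw [inv_neg, inv_div]
  congr 2 <;> ring

theorem Twist.cases {a b : Name k} (h : Twist a b) :
    a = b ∨ (∃ β, a = .J23 β ∧ b = .J23 (-β)) ∨ (∃ δ, a = .J26 δ ∧ b = .J26 (-δ)) ∨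
      ∃ ε φ, a = .J27 ε φ ∧ b = .J27 φ ε := by
  cases h <;> simp

/-- The two names are equal or listed as coinciding. -/
def Match (a b : Name k) : Prop := a = b ∨ Coincide a b ∨ Coincide b a

theorem Match.symm {a b : Name k} (h : Match a b) : Match b a := by
  rcases h with h | h | h
  exacts [Or.inl h.symm, Or.inr (Or.inr h), Or.inr (Or.inl h)]

theorem Twist.symm {a b : Name k} (h : Twist a b) : Twist b a := by
  cases h
  · exact Twist.refl _
  · simpa using Twist.j23 (-_ : k)
  · simpa using Twist.j26 (-_ : k)
  · exact Twist.j27 _ _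

theorem Twist.match {a b : Name k} (h : Twist a b) : Match a b := by
  cases h
  · exact Or.inl rfl
  · exact Or.inr (Or.inl (Coincide.j23 _))
  · exact Or.inr (Or.inl (Coincide.j26 _))
  · exact Or.inr (Or.inl (Coincide.j27 _ _))

theorem match_of_red_self {a b d : Name k} (hb : Red b d) (ht : Twist a d) : Match a b := by
  cases hb
  case parR | parS => exact ht.match
  all_goals have h := ht.cases; simp at h
  case e4 => subst h; exact Or.inr (Or.inl Coincide.j24_one)
  case j29 => subst h; exact Or.inr (Or.inr Coincide.j29)
  case j37 => subst h; exact Or.inr (Or.inr Coincide.j37)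
  case j41_one => subst h; exact Or.inr (Or.inr Coincide.j41_one)
  case j41 l s ε h0 h1 hs hε =>
    rcases h with rfl | rfl
    · exact Or.inr (Or.inr (Coincide.j41_j27 l s ε h0 h1 hs hε))
    · have := Coincide.j41_j27 l (-s) ε⁻¹ h0 h1 (by rw [neg_sq, hs]) (by rw [hε, inv_param])
      rw [inv_inv] at this
      exact Or.inr (Or.inr this)

theorem match_of_red (h2 : (2 : k) ≠ 0) {a b c d : Name k} (ha : Red a c) (hb : Red b d)
    (ht : Twist c d) : Match a b := by
  have hs : ∀ {l s ε : k}, s ^ 2 = l → l ≠ 0 → l ≠ 1 → ε = -((-1 + s) ^ 2 / (1 + s) ^ 2) →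
      ε ≠ -1 := by
    rintro l s ε hs h0 h1 hε rfl
    have ha : 1 + s ≠ 0 := fun h => h1 (by linear_combination (s - 1) * h - hs)
    rw [eq_comm, neg_inj, div_eq_one_iff_eq (pow_ne_zero 2 ha)] at hε
    have : (2 * 2) * s = 0 := by linear_combination -hε
    have := (mul_eq_zero.1 this).resolve_left (mul_ne_zero h2 h2)
    exact h0 (by rw [← hs, this]; ring)
  cases ha
  case parR | parS => exact match_of_red_self hb ht
  all_goals
    cases hb
    case parR | parS => exact (match_of_red_self (by constructor <;> assumption) ht.symm).symm
    all_goals try exact Or.inl rfl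
    all_goals have h := ht.cases; simp at h
  case j37.j41 l s ε h0 h1 hs' hε =>
    refine absurd ?_ (hs hs' h0 h1 hε)
    rcases h with h | h
    exacts [h.1.symm, h.1]
  case j41.j37 l s ε h0 h1 hs' hε =>
    refine absurd ?_ (hs hs' h0 h1 hε)
    rcases h with h | h
    exacts [h.1, h.2.symm]
  case j41.j41 l s ε h0 h1 hs' hε l' s' ε' h0' h1' hs'' hε' =>
    have key : l' = l ∨ l' = l⁻¹ := by
      rcases h with h | ⟨h, -⟩
      · exact eq_or_inv_of_same h2 h0 h1 hs' h1' hs'' (neg_injective (by rw [← hε, ← hε', h]))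
      · exact eq_or_inv_of_same h2 h0 h1 (s := -s) (by rw [neg_sq, hs']) h1' hs''
          (neg_injective (by rw [← inv_param, ← hε, ← hε', h]))
    rcases key with rfl | rfl
    · exact Or.inl rfl
    · exact Or.inr (Or.inl (Coincide.j41 l h0))

theorem match_of_sig [IsAlgClosed k] (h2 : (2 : k) ≠ 0) {a b : Name k}
    (h : a.sig = (3, 1, 0)) (hi : Isomorphic k a.Alg b.Alg) : Match a b := by
  obtain ⟨c, ha⟩ := exists_red h
  obtain ⟨d, hb⟩ := exists_red (Name.sig_eq hi ▸ h)
  exact match_of_red h2 ha hb (ha.twist h2 hb hi)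

/-! ### Algebras with one-dimensional square, or with two-dimensional square and nonzero cube -/

open Gen in
/-- A table of an isomorphic algebra in which `n_i * n_j` is always a multiple of a basis element,
and the nonzero products with a fixed `n_j` are linearly independent. -/
def Name.alt : Name k → Table k
  | .J1 => [(n1, n1, n2, 1), (n2, n4, n3, 1)]
  | .J2 => [(n1, n4, n2, 2), (n1, n2, n3, 2)]
  | .J3 => [(n1, n4, n2, 1), (n4, n4, n3, -1), (n1, n2, n3, 2 * 2)]
  | .J10 => [(n1, n1, n3, 2), (n2, n2, n3, -2), (n1, n3, n5, 2), (n4, n4, n5, 1)]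
  | .J13 => [(n1, n1, n3, 2), (n2, n2, n3, -2), (n1, n3, n5, 2), (n2, n4, n5, 1)]
  | a => a.table

open Gen in
theorem Name.iso_alt (h2 : (2 : k) ≠ 0) (a : Name k) : Isomorphic k a.alt.Alg a.Alg := by
  cases a
  case J1 =>
    refine isomorphic_of_lin_rows
      [(n1, n1, 1), (n1, n4, -1), (n2, n2, 1), (n3, n3, 1), (n4, n4, 1), (n5, n5, 1)]
      [(n1, n1, 1), (n1, n4, 1), (n2, n2, 1), (n3, n3, 1), (n4, n4, 1), (n5, n5, 1)] ?_ ?_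
    · intro x l; cases l <;> simp [lin]
    · intro x y l; cases l <;> simp [lin, rowMul, Name.table, Name.alt]; ring
  case J2 =>
    refine isomorphic_of_lin_rows
      [(n1, n1, 1), (n1, n4, 1), (n2, n2, 1), (n3, n3, 1), (n4, n1, 1), (n4, n4, -1), (n5, n5, 1)]
      [(n1, n1, 1 / 2), (n1, n4, 1 / 2), (n2, n2, 1), (n3, n3, 1), (n4, n1, 1 / 2),
        (n4, n4, -1 / 2), (n5, n5, 1)] ?_ ?_
    · intro x l; cases l <;> simp [lin] <;> field_simp <;> ring
    · intro x y l; cases l <;> simp [lin, rowMul, Name.table, Name.alt] <;> ring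
  case J3 =>
    refine isomorphic_of_lin_rows
      [(n1, n1, 1), (n1, n4, 1), (n1, n2, 1 / 2 ^ 2), (n1, n3, 1 / 2 ^ 3), (n2, n2, 2), (n2, n3, 1),
        (n3, n3, 1), (n4, n1, 1), (n4, n4, -1), (n5, n5, 1)]
      [(n1, n1, 1 / 2), (n1, n2, -1 / 2 ^ 4), (n1, n4, 1 / 2), (n2, n2, 1 / 2), (n2, n3, -1 / 2),
        (n3, n3, 1), (n4, n1, 1 / 2), (n4, n2, -1 / 2 ^ 4), (n4, n4, -1 / 2), (n5, n5, 1)] ?_ ?_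
    · intro x l; cases l <;> simp [lin] <;> field_simp <;> ring
    · intro x y l; cases l <;> simp [lin, rowMul, Name.table, Name.alt] <;> field_simp <;> ring
  case J10 =>
    refine isomorphic_of_lin_rows
      [(n1, n1, 1), (n1, n2, 1), (n2, n1, 1), (n2, n2, -1), (n3, n3, 1), (n4, n4, 1), (n5, n5, 1)]
      [(n1, n1, 1 / 2), (n1, n2, 1 / 2), (n2, n1, 1 / 2), (n2, n2, -1 / 2), (n3, n3, 1),
        (n4, n4, 1), (n5, n5, 1)] ?_ ?_
    · intro x l; cases l <;> simp [lin] <;> field_simp <;> ring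
    · intro x y l; cases l <;> simp [lin, rowMul, Name.table, Name.alt] <;> ring
  case J13 =>
    refine isomorphic_of_lin_rows
      [(n1, n1, 1), (n1, n2, 1), (n2, n1, 1), (n2, n2, -1), (n3, n3, 1), (n4, n4, 1),
        (n4, n3, -1 / 2), (n5, n5, 1)]
      [(n1, n1, 1 / 2), (n1, n2, 1 / 2), (n2, n1, 1 / 2), (n2, n2, -1 / 2), (n3, n3, 1),
        (n4, n4, 1), (n4, n3, 1 / 2), (n5, n5, 1)] ?_ ?_
    · intro x l; cases l <;> simp [lin] <;> field_simp <;> ring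
    · intro x y l; cases l <;> simp [lin, rowMul, Name.table, Name.alt] <;> field_simp <;> ring
  all_goals exact Isomorphic.refl _

/-- The triples together with those with the first two entries exchanged. -/
def Pat.sym (p : Pat) : Pat := p ++ p.map fun r => (r.2.1, r.1, r.2.2)

/-- Different basis elements have different nonzero products with a fixed one. -/
def Pat.Separated (p : Pat) : Bool :=
  p.sym.all fun r => allGen fun i => i == r.1 || !p.rel i r.2.1 r.2.2

theorem Table.coeff_sym {T : Table k} (hT : T.pat.Pairwise Pat.Apart) (h0 : ∀ r ∈ T, r.2.2.2 ≠ 0)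
    (hs : T.pat.Separated = true) :
    ∀ r ∈ T.pat.sym, T.coeff r.1 r.2.1 r.2.2 ≠ 0 ∧ ∀ i, i ≠ r.1 → T.coeff i r.2.1 r.2.2 = 0 := by
  intro r hr
  constructor
  · rcases List.mem_append.1 hr with h | h
    · obtain ⟨q, hq, rfl⟩ := List.mem_map.1 h
      rw [(Table.coeff_of_pairwise hT q hq).1]
      exact h0 q hq
    · obtain ⟨q', hq', rfl⟩ := List.mem_map.1 h
      obtain ⟨q, hq, rfl⟩ := List.mem_map.1 hq'
      rw [T.coeff_comm, (Table.coeff_of_pairwise hT q hq).1]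
      exact h0 q hq
  · intro i hi
    rw [Pat.Separated, List.all_eq_true] at hs
    have := allGen_iff.1 (hs r hr) i
    by_contra hc
    simp [hi, rel_pat_of_coeff_ne_zero hc] at this

theorem Name.pat_alt_toRat (a : Name k) : a.alt.pat = a.toRat.alt.pat := by cases a <;> rfl

/-- The algebra has a one-dimensional square, or a two-dimensional square and a nonzero cube. -/
def Name.IsMono (a : Name k) : Prop := a.sig = (1, 0, 0) ∨ a.sig = (2, 1, 0)

instance (a : Name k) : Decidable a.IsMono := by unfold Name.IsMono; infer_instance

theorem Name.isMono_toRat (a : Name k) : a.toRat.IsMono ↔ a.IsMono := by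
  rw [Name.IsMono, a.sig_toRat]; rfl

theorem Name.alt_check {a : Name k} (h : a.IsMono) :
    a.toRat.alt.pat.Pairwise Pat.Apart ∧ a.toRat.alt.pat.Separated = true := by
  rw [← a.isMono_toRat] at h
  cases a <;> simp only [Name.toRat] at h ⊢ <;> revert h <;> decide +kernel

theorem Name.alt_ne_zero (h2 : (2 : k) ≠ 0) {a : Name k} (h : a.IsMono) :
    ∀ r ∈ a.alt, r.2.2.2 ≠ 0 := by
  cases a <;> try (simp [Name.IsMono, Name.sig] at h; done)
  all_goals simp [Name.alt, Name.table, h2]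

theorem Name.eval_alt (h2 : (2 : k) ≠ 0) {a : Name k} (h : a.IsMono) (φ : Fm) (s : Gen → Bool)
    (hs : φ.Exact a.toRat.alt.pat a.toRat.alt.pat a.toRat.alt.pat.sym s = true) :
    φ.eval k a.alt.Alg = coord a.alt s := by
  rw [← a.pat_alt_toRat] at hs
  have hc := Name.alt_check h
  rw [← a.pat_alt_toRat] at hc
  have h0 := Name.alt_ne_zero h2 h
  refine Fm.eval_eq_of_exact (fun i j l hc => rel_pat_of_coeff_ne_zero hc) ?_
    (Table.coeff_sym hc.1 h0 hc.2) φ s hs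
  refine Table.coeff_of_pairwise' hc.1 fun q hq => ?_
  obtain ⟨r, hr, rfl⟩ := List.mem_map.1 hq
  exact ⟨r, hr, rfl, h0 r hr⟩

namespace Fm

/-- The annihilator of the square. -/
def annSq : Fm := colon sq bot

/-- The elements whose products lie in the cube. -/
def rad : Fm := colon top cube

/-- The elements of `annSq` whose products with `annSq` lie in the cube. -/
def annRad : Fm := inf annSq (colon annSq cube)

/-- Five formulas whose values have characteristic dimensions. -/
def tests : List Fm :=
  [colon annSq cube, colon rad bot, mul (colon sq (mul annSq annSq)) annRad,
    inf (colon annRad bot) annRad, mul rad rad]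

end Fm

/-- The dimensions of the values of the formulas in `Fm.tests`. -/
def Name.inv : Name k → List ℕ
  | .E13 => [5, 2, 1, 2, 1]
  | .E14 => [5, 3, 1, 3, 1]
  | .E18 => [5, 4, 0, 4, 0]
  | .J1 => [4, 3, 0, 3, 1]
  | .J2 => [4, 4, 0, 4, 0]
  | .J3 => [4, 4, 2, 3, 0]
  | .J4 => [4, 4, 0, 3, 0]
  | .J5 => [4, 2, 1, 2, 1]
  | .J6 => [4, 2, 1, 3, 1]
  | .J7 => [3, 3, 0, 2, 1]
  | .J8 | .J9 => [3, 3, 1, 2, 1]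
  | .J10 => [4, 3, 1, 2, 1]
  | .J11 => [4, 3, 2, 3, 1]
  | .J12 => [4, 3, 2, 2, 1]
  | .J13 => [4, 3, 1, 3, 0]
  | .J14 => [4, 3, 2, 2, 0]
  | .J16 => [3, 4, 0, 3, 0]
  | .J17 => [3, 4, 2, 3, 0]
  | .J18 => [3, 4, 2, 2, 0]
  | .J19 => [3, 4, 0, 2, 0]
  | .J20 | .J21 => [3, 4, 1, 2, 0]
  | .E21 => [1, 5, 0, 1, 0]
  | .E22 => [2, 5, 0, 2, 0]
  | .E23 => [3, 5, 0, 3, 0]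
  | .E24 => [4, 5, 0, 4, 0]
  | _ => []

theorem Name.tests_check {a : Name k} (h : a.IsMono) :
    (∀ φ ∈ Fm.tests, φ.Exact a.toRat.alt.pat a.toRat.alt.pat a.toRat.alt.pat.sym
      (φ.comb a.toRat.alt.pat a.toRat.alt.pat a.toRat.alt.pat.sym true) = true) ∧
    (Fm.tests.map fun φ => cardGen
      (φ.comb a.toRat.alt.pat a.toRat.alt.pat a.toRat.alt.pat.sym true)) = a.toRat.inv := by
  rw [← a.isMono_toRat] at h
  cases a <;> simp only [Name.toRat] at h ⊢ <;> revert h <;> decide +kernel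

theorem Name.inv_toRat (a : Name k) : a.toRat.inv = a.inv := by cases a <;> rfl

theorem Name.finrank_tests (h2 : (2 : k) ≠ 0) {a : Name k} (h : a.IsMono) :
    (Fm.tests.map fun φ => Module.finrank k (φ.eval k a.Alg)) = a.inv := by
  obtain ⟨f, hf⟩ := a.iso_alt h2
  rw [← a.inv_toRat, ← (Name.tests_check h).2]
  refine List.map_congr_left fun φ hφ => ?_
  rw [← Fm.finrank_eval f hf, Name.eval_alt h2 h φ _ ((Name.tests_check h).1 φ hφ),
    finrank_coord_eq]

theorem Name.inv_eq (h2 : (2 : k) ≠ 0) {a b : Name k} (ha : a.IsMono) (hb : b.IsMono)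
    (h : Isomorphic k a.Alg b.Alg) : a.inv = b.inv := by
  obtain ⟨f, hf⟩ := h
  rw [← Name.finrank_tests h2 ha, ← Name.finrank_tests h2 hb]
  simp only [Fm.finrank_eval f hf]

/-- The algebras that are determined by the dimensions of their powers and by `Name.inv`. -/
def Name.monos : List (Name k) :=
  [.E13, .E14, .E18, .J1, .J2, .J3, .J4, .J5, .J6, .J7, .J8, .J10, .J11, .J12, .J13, .J14, .J16,
    .J17, .J18, .J19, .J20, .E21, .E22, .E23, .E24]

theorem Name.find_monos {a : Name k} (h : a.IsMono) :
    Name.monos.find? (fun b : Name k => b.inv == a.inv) = some a ∨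
    (a = .J9 ∧ Name.monos.find? (fun b : Name k => b.inv == a.inv) = some .J8) ∨
    (a = .J21 ∧ Name.monos.find? (fun b : Name k => b.inv == a.inv) = some .J20) := by
  cases a <;> try (simp [Name.IsMono, Name.sig] at h; done)
  case J9 => exact Or.inr (Or.inl ⟨rfl, rfl⟩)
  case J21 => exact Or.inr (Or.inr ⟨rfl, rfl⟩)
  all_goals exact Or.inl rfl

theorem eq_of_inv_eq {a b : Name k} (ha : a.IsMono) (hb : b.IsMono) (h : a.inv = b.inv) :
    a = b ∨ (a = .J8 ∧ b = .J9) ∨ (a = .J9 ∧ b = .J8) ∨ (a = .J20 ∧ b = .J21) ∨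
      (a = .J21 ∧ b = .J20) := by
  have h1 := Name.find_monos ha
  have h2 := Name.find_monos hb
  rw [h] at h1
  rcases h1 with h1 | ⟨rfl, h1⟩ | ⟨rfl, h1⟩ <;> rcases h2 with h2 | ⟨rfl, h2⟩ | ⟨rfl, h2⟩ <;>
    rw [h1] at h2 <;> simp_all

/-! ### Further invariant properties -/

theorem mem_sq {a : Name k} (s : List Gen)
    (h : ∀ l, a.toRat.powers.1 l = !s.contains l) (x : a.Alg) :
    x ∈ Fm.sq.eval k a.Alg ↔ ∀ l ∈ s, x l = 0 := by
  rw [a.eval_powers.1, mem_coord]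
  simp [h]

theorem mem_cube {a : Name k} (s : List Gen)
    (h : ∀ l, a.toRat.powers.2.1 l = !s.contains l) (x : a.Alg) :
    x ∈ Fm.cube.eval k a.Alg ↔ ∀ l ∈ s, x l = 0 := by
  rw [a.eval_powers.2.1, mem_coord]
  simp [h]

theorem mem_fourth {a : Name k} (s : List Gen)
    (h : ∀ l, a.toRat.powers.2.2 l = !s.contains l) (x : a.Alg) :
    x ∈ Fm.fourth.eval k a.Alg ↔ ∀ l ∈ s, x l = 0 := by
  rw [a.eval_powers.2.2, mem_coord]
  simp [h]

/-- The annihilator. -/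
def Fm.ann : Fm := .colon .top .bot

section Properties

variable (k) (A : Type*) [NonUnitalNonAssocCommRing A] [Module k A] [IsScalarTower k A A]

/-- The elements of `φ` whose square lies in `ψ` belong to `χ`. -/
def SqIn (φ ψ χ : Fm) : Prop :=
  ∀ x ∈ φ.eval k A, x * x ∈ ψ.eval k A → x ∈ χ.eval k A

/-- The product of two indecomposable elements whose squares lie in `φ` also lies in `φ`. -/
def SqMul (φ : Fm) : Prop :=
  ∀ x y : A, x ∉ Fm.sq.eval k A → y ∉ Fm.sq.eval k A →
    x * x ∈ φ.eval k A → y * y ∈ φ.eval k A → x * y ∈ φ.eval k A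

/-- The multiples of `x` span at most a line. -/
def Thin {A : Type*} [NonUnitalNonAssocCommRing A] [Module k A] (x : A) : Prop :=
  ∀ y z : A, ∃ s t : k, (s ≠ 0 ∨ t ≠ 0) ∧ s • (x * y) + t • (x * z) = 0

def SqThin : Prop := ∀ x : A, x ∉ Fm.sq.eval k A → x * x = 0 → Thin k x

def SqThinAnn : Prop := ∀ x : A, x * x = 0 → Thin k x → x ∈ Fm.ann.eval k A

def ThinSq : Prop := ∀ x : A, Thin k x → x * x = 0

def ThinLine : Prop := ∀ x y : A, Thin k x → Thin k y →
  ∃ s t : k, (s ≠ 0 ∨ t ≠ 0) ∧ s • x + t • y ∈ Fm.ann.eval k A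

def AnnInSq : Prop := Fm.ann.eval k A ≤ Fm.sq.eval k A

end Properties

section Invariance

variable {A B : Type*} [NonUnitalNonAssocCommRing A] [Module k A] [IsScalarTower k A A]
  [NonUnitalNonAssocCommRing B] [Module k B] [IsScalarTower k B B]

theorem SqIn.of_iso {φ ψ χ : Fm} (h : Isomorphic k A B) (hA : SqIn k A φ ψ χ) :
    SqIn k B φ ψ χ := by
  obtain ⟨f, hf⟩ := h
  intro x h1 h2
  obtain ⟨x, rfl⟩ := f.surjective x
  rw [← hf] at h2
  rw [Fm.map_mem_eval f hf] at h1 h2 ⊢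
  exact hA x h1 h2

theorem SqMul.of_iso {φ : Fm} (h : Isomorphic k A B) (hA : SqMul k A φ) : SqMul k B φ := by
  obtain ⟨f, hf⟩ := h
  intro x y hx hy h1 h2
  obtain ⟨x, rfl⟩ := f.surjective x
  obtain ⟨y, rfl⟩ := f.surjective y
  rw [Fm.map_mem_eval f hf] at hx hy
  rw [← hf, Fm.map_mem_eval f hf] at h1 h2 ⊢
  exact hA x y hx hy h1 h2

theorem thin_map (f : A ≃ₗ[k] B) (hf : ∀ x y, f (x * y) = f x * f y) (x : A) :
    Thin k (f x) ↔ Thin k x := by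
  constructor
  · intro h y z
    obtain ⟨s, t, h0, h1⟩ := h (f y) (f z)
    refine ⟨s, t, h0, ?_⟩
    simpa only [← hf, ← map_smul, ← map_add, EmbeddingLike.map_eq_zero_iff] using h1
  · intro h y z
    obtain ⟨y, rfl⟩ := f.surjective y
    obtain ⟨z, rfl⟩ := f.surjective z
    obtain ⟨s, t, h0, h1⟩ := h y z
    refine ⟨s, t, h0, ?_⟩
    simpa only [← hf, ← map_smul, ← map_add, EmbeddingLike.map_eq_zero_iff] using h1

theorem map_mul_self_eq_zero (f : A ≃ₗ[k] B) (hf : ∀ x y, f (x * y) = f x * f y) (x : A) :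
    f x * f x = 0 ↔ x * x = 0 := by
  rw [← hf, EmbeddingLike.map_eq_zero_iff]

theorem SqThin.of_iso (h : Isomorphic k A B) (hA : SqThin k A) : SqThin k B := by
  obtain ⟨f, hf⟩ := h
  intro x h0 h1
  obtain ⟨x, rfl⟩ := f.surjective x
  rw [Fm.map_mem_eval f hf] at h0
  rw [map_mul_self_eq_zero f hf] at h1
  exact (thin_map f hf x).2 (hA x h0 h1)

theorem SqThinAnn.of_iso (h : Isomorphic k A B) (hA : SqThinAnn k A) : SqThinAnn k B := by
  obtain ⟨f, hf⟩ := h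
  intro x h1 h2
  obtain ⟨x, rfl⟩ := f.surjective x
  rw [map_mul_self_eq_zero f hf] at h1
  exact (Fm.map_mem_eval f hf _ x).2 (hA x h1 ((thin_map f hf x).1 h2))

theorem ThinSq.of_iso (h : Isomorphic k A B) (hA : ThinSq k A) : ThinSq k B := by
  obtain ⟨f, hf⟩ := h
  intro x h1
  obtain ⟨x, rfl⟩ := f.surjective x
  exact (map_mul_self_eq_zero f hf x).2 (hA x ((thin_map f hf x).1 h1))

theorem ThinLine.of_iso (h : Isomorphic k A B) (hA : ThinLine k A) : ThinLine k B := by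
  obtain ⟨f, hf⟩ := h
  intro x y h1 h2
  obtain ⟨x, rfl⟩ := f.surjective x
  obtain ⟨y, rfl⟩ := f.surjective y
  obtain ⟨s, t, h0, h3⟩ := hA x y ((thin_map f hf x).1 h1) ((thin_map f hf y).1 h2)
  exact ⟨s, t, h0, by rw [← map_smul, ← map_smul, ← map_add, Fm.map_mem_eval f hf]; exact h3⟩

theorem AnnInSq.of_iso (h : Isomorphic k A B) (hA : AnnInSq k A) : AnnInSq k B := by
  obtain ⟨f, hf⟩ := h
  intro x h1
  obtain ⟨x, rfl⟩ := f.surjective x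
  rw [Fm.map_mem_eval f hf] at h1 ⊢
  exact hA h1

theorem IsAssociative.of_iso (h : Isomorphic k A B) (hA : IsAssociative A) : IsAssociative B := by
  obtain ⟨f, hf⟩ := h
  intro x y z
  obtain ⟨x, rfl⟩ := f.surjective x
  obtain ⟨y, rfl⟩ := f.surjective y
  obtain ⟨z, rfl⟩ := f.surjective z
  rw [← hf, ← hf, ← hf, ← hf, hA]

theorem thin_of_line {x m : A} (c : A → k) (h : ∀ y, x * y = c y • m) : Thin k x := by
  intro y z
  by_cases hy : c y = 0
  · exact ⟨1, 0, by simp, by simp [h, hy]⟩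
  · refine ⟨c z, -c y, Or.inr (neg_ne_zero.2 hy), ?_⟩
    rw [h, h, smul_smul, smul_smul, ← add_smul, show c z * c y + -c y * c z = 0 by ring, zero_smul]

theorem mem_ann {x : A} : x ∈ Fm.ann.eval k A ↔ ∀ y : A, x * y = 0 := by
  simp [Fm.ann, Fm.eval]

end Invariance

theorem Thin.det {T : Table k} {x : T.Alg} (h : Thin k x) (y z : T.Alg) (i j : Gen) :
    (x * y) i * (x * z) j = (x * y) j * (x * z) i := by
  obtain ⟨s, t, h0, h1⟩ := h y z
  have hi : s * (x * y) i + t * (x * z) i = 0 := congrFun h1 i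
  have hj : s * (x * y) j + t * (x * z) j = 0 := congrFun h1 j
  rcases h0 with h0 | h0
  · exact mul_left_cancel₀ h0 (by linear_combination (x * z) j * hi - (x * z) i * hj)
  · exact mul_left_cancel₀ h0 (by linear_combination (x * y) i * hj - (x * y) j * hi)

section

open Gen

theorem mem_bot {A : Type*} [NonUnitalNonAssocCommRing A] [Module k A] [IsScalarTower k A A]
    {x : A} : x ∈ Fm.bot.eval k A ↔ x = 0 := Submodule.mem_bot k

theorem bas_notMem_ann {T : Table k} {i j l : Gen} (h : T.coeff i j l ≠ 0) :
    bas T i ∉ Fm.ann.eval k T.Alg := fun hi =>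
  h (by rw [← bas_mul_bas, mem_ann.1 hi]; rfl)

theorem bas_mul_bas_ne {T : Table k} {i j l : Gen} (h : T.coeff i j l ≠ 0) :
    bas T i * bas T j ≠ 0 := fun h0 => h (by rw [← bas_mul_bas, h0]; rfl)

theorem bas_mul_self_eq_zero {T : Table k} {i : Gen} (h : ∀ l, T.coeff i i l = 0) :
    bas T i * bas T i = 0 := alg_ext fun l => by rw [bas_mul_bas, h]; rfl

theorem bas_notMem_sq {a : Name k} {i : Gen} (h : a.toRat.powers.1 i = false) :
    bas a.table i ∉ Fm.sq.eval k a.Alg := by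
  intro hi
  rw [a.eval_powers.1, mem_coord] at hi
  simpa [bas_apply] using hi i h

theorem not_sqIn_of_bas {T : Table k} {φ : Fm} {i : Gen} (h : ∀ l, T.coeff i i l = 0)
    (hi : bas T i ∉ φ.eval k T.Alg) : ¬ SqIn k T.Alg .top .bot φ := fun H =>
  hi (H _ trivial (mem_bot.2 (bas_mul_self_eq_zero h)))

theorem not_sqMul_of_bas {a : Name k} {i j l : Gen} (hi : a.toRat.powers.1 i = false)
    (hj : a.toRat.powers.1 j = false) (h : ∀ l, a.table.coeff i i l = 0)
    (h' : ∀ l, a.table.coeff j j l = 0) (hl : a.table.coeff i j l ≠ 0) :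
    ¬ SqMul k a.Alg .bot := fun H =>
  bas_mul_bas_ne hl (mem_bot.1 (H _ _ (bas_notMem_sq hi) (bas_notMem_sq hj)
    (mem_bot.2 (bas_mul_self_eq_zero h)) (mem_bot.2 (bas_mul_self_eq_zero h'))))

theorem Thin.bas {T : Table k} {i : Gen} (h : Thin k (bas T i)) (p q l m : Gen) :
    T.coeff i p l * T.coeff i q m = T.coeff i p m * T.coeff i q l := by
  simpa only [bas_mul_bas] using h.det (NilJordan.bas T p) (NilJordan.bas T q) l m

theorem not_sqThin_of_bas {a : Name k} {i p q l m : Gen} (hi : a.toRat.powers.1 i = false)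
    (h : ∀ l, a.table.coeff i i l = 0)
    (hl : a.table.coeff i p l * a.table.coeff i q m ≠ a.table.coeff i p m * a.table.coeff i q l) :
    ¬ SqThin k a.Alg := fun H =>
  hl ((H _ (bas_notMem_sq hi) (bas_mul_self_eq_zero h)).bas p q l m)

theorem bas_thin {T : Table k} {i : Gen} (l : Gen) (h : ∀ j m, m ≠ l → T.coeff i j m = 0) :
    Thin k (bas T i) := by
  refine thin_of_line (m := bas T l) (fun y => (bas T i * y) l) fun y => alg_ext fun m => ?_
  by_cases hm : m = l
  · subst hm; simp [bas_apply]
  · simp [bas_apply, Ne.symm hm, bas_mul, h _ m hm]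

theorem not_sqThinAnn_of_bas {T : Table k} {i j : Gen} (l : Gen) (h : ∀ l, T.coeff i i l = 0)
    (h' : ∀ j m, m ≠ l → T.coeff i j m = 0) (hl : T.coeff i j l ≠ 0) :
    ¬ SqThinAnn k T.Alg := fun H =>
  bas_notMem_ann hl (H _ (bas_mul_self_eq_zero h) (bas_thin l h'))

/-- The basis elements of a listed algebra. -/
def Name.e (a : Name k) (i : Gen) : a.Alg := bas a.table i

theorem Name.e_apply (a : Name k) (i j : Gen) : a.e i j = if i = j then 1 else 0 := rfl

theorem Name.e_mul_e (a : Name k) (i j l : Gen) : (a.e i * a.e j) l = a.table.coeff i j l :=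
  bas_mul_bas _ _ _ _

/-! ### Algebras with two-dimensional square and zero cube -/

theorem sqIn_E19 : SqIn k (Name.Alg (k := k) .E19) .top .bot .ann := by
  intro x _ hx
  replace hx := eq_zero_iff.1 hx
  simp [mul_apply_rows, Name.table, rowMul] at hx
  refine mem_ann.2 fun y => eq_zero_iff.2 ?_
  simp [mul_apply_rows, Name.table, rowMul, hx]

theorem not_sqIn_E17 : ¬ SqIn k (Name.Alg (k := k) .E17) .top .bot .ann :=
  not_sqIn_of_bas (i := n2) (by simp [Name.table, Table.coeff])
    (bas_notMem_ann (j := n1) (l := n5) (by simp [Name.table, Table.coeff]))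

theorem not_sqIn_E20 : ¬ SqIn k (Name.Alg (k := k) .E20) .top .bot .ann :=
  not_sqIn_of_bas (i := n3) (by simp [Name.table, Table.coeff])
    (bas_notMem_ann (j := n1) (l := n4) (by simp [Name.table, Table.coeff]))

theorem sqMul_of_sqIn {A : Type*} [NonUnitalNonAssocCommRing A] [Module k A]
    [IsScalarTower k A A] (h : SqIn k A .top .bot .ann) : SqMul k A .bot :=
  fun x y _ _ h1 _ => mem_bot.2 (mem_ann.1 (h x trivial h1) y)

theorem sqMul_E17 : SqMul k (Name.Alg (k := k) .E17) .bot := by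
  intro x y _ _ hx hy
  replace hx := eq_zero_iff.1 hx
  replace hy := eq_zero_iff.1 hy
  simp [mul_apply_rows, Name.table, rowMul] at hx hy
  obtain ⟨h1, h2⟩ := hx
  obtain ⟨h3, h4⟩ := hy
  simp [h1] at h2
  simp [h3] at h4
  refine mem_bot.2 (eq_zero_iff.2 ?_)
  simp [mul_apply_rows, Name.table, rowMul, h1, h2, h3, h4]

theorem sqMul_E20 : SqMul k (Name.Alg (k := k) .E20) .bot := by
  intro x y _ _ hx hy
  replace hx := eq_zero_iff.1 hx
  replace hy := eq_zero_iff.1 hy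
  simp [mul_apply_rows, Name.table, rowMul] at hx hy
  refine mem_bot.2 (eq_zero_iff.2 ?_)
  simp [mul_apply_rows, Name.table, rowMul, hx.1, hy.1]

theorem not_sqMul_E7 : ¬ SqMul k (Name.Alg (k := k) .E7) .bot :=
  not_sqMul_of_bas (i := n1) (j := n3) (l := n4) rfl rfl (by simp [Name.table, Table.coeff])
    (by simp [Name.table, Table.coeff]) (by simp [Name.table, Table.coeff])

theorem not_sqMul_E9 : ¬ SqMul k (Name.Alg (k := k) .E9) .bot :=
  not_sqMul_of_bas (i := n1) (j := n3) (l := n5) rfl rfl (by simp [Name.table, Table.coeff])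
    (by simp [Name.table, Table.coeff]) (by simp [Name.table, Table.coeff])

theorem not_sqMul_E11 : ¬ SqMul k (Name.Alg (k := k) .E11) .bot :=
  not_sqMul_of_bas (i := n2) (j := n3) (l := n4) rfl rfl (by simp [Name.table, Table.coeff])
    (by simp [Name.table, Table.coeff]) (by simp [Name.table, Table.coeff])

theorem not_sqMul_E12 : ¬ SqMul k (Name.Alg (k := k) .E12) .bot :=
  not_sqMul_of_bas (i := n1) (j := n2) (l := n4) rfl rfl (by simp [Name.table, Table.coeff])
    (by simp [Name.table, Table.coeff]) (by simp [Name.table, Table.coeff])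

theorem not_sqMul_E15 [IsAlgClosed k] (h2 : (2 : k) ≠ 0) :
    ¬ SqMul k (Name.Alg (k := k) .E15) .bot := by
  intro H
  obtain ⟨t, ht⟩ := IsAlgClosed.exists_pow_nat_eq (-1 : k) (n := 2) (by norm_num)
  have hv : ∀ c : k, c ^ 2 = -1 → ∃ x : Name.Alg (k := k) .E15,
      x n1 = 1 ∧ x n2 = c ∧ x ∉ Fm.sq.eval k (Name.Alg (k := k) .E15) ∧ x * x = 0 := by
    intro c hc
    obtain ⟨x, hx1, hx2, hx4⟩ : ∃ x : Name.Alg (k := k) .E15, x n1 = 1 ∧ x n2 = c ∧ x n4 = 0 :=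
      ⟨Name.e _ n1 + c • Name.e _ n2, by simp only [add_coord, smul_coord]; simp [Name.e_apply]⟩
    refine ⟨x, hx1, hx2, fun h => ?_, eq_zero_iff.2 ?_⟩
    · rw [mem_sq [n1, n2, n4] (by intro l; cases l <;> rfl)] at h
      simpa [hx1] using h n1 (by simp)
    · simp [mul_apply_rows, Name.table, rowMul, hx1, hx2, hx4]
      linear_combination hc
  obtain ⟨x, hx1, hx2, hx, hxx⟩ := hv t ht
  obtain ⟨y, hy1, hy2, hy, hyy⟩ := hv (-t) (by rw [neg_sq, ht])
  have h := eq_zero_iff.1 (H x y hx hy (mem_bot.2 hxx) (mem_bot.2 hyy))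
  simp [mul_apply_rows, Name.table, rowMul, hx1, hx2, hy1, hy2] at h
  exact h2 (by linear_combination h.1 + ht)

theorem sqThin_E15 : SqThin k (Name.Alg (k := k) .E15) := by
  intro x _ hx
  replace hx := eq_zero_iff.1 hx
  simp [mul_apply_rows, Name.table, rowMul] at hx
  refine thin_of_line (m := Name.e _ n3) (fun y => x n1 * y n1 + x n2 * y n2) fun y =>
    alg_ext (forall_gen.2 ?_)
  simp [mul_apply_rows, Name.table, rowMul, hx.2, Name.e_apply]

theorem not_sqThin_E7 : ¬ SqThin k (Name.Alg (k := k) .E7) :=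
  not_sqThin_of_bas (i := n1) (p := n3) (q := n2) (l := n4) (m := n5) rfl
    (by simp [Name.table, Table.coeff]) (by simp [Name.table, Table.coeff])

theorem not_sqThin_E9 : ¬ SqThin k (Name.Alg (k := k) .E9) :=
  not_sqThin_of_bas (i := n1) (p := n2) (q := n3) (l := n4) (m := n5) rfl
    (by simp [Name.table, Table.coeff]) (by simp [Name.table, Table.coeff])

theorem not_sqThin_E11 : ¬ SqThin k (Name.Alg (k := k) .E11) :=
  not_sqThin_of_bas (i := n3) (p := n2) (q := n1) (l := n4) (m := n5) rfl
    (by simp [Name.table, Table.coeff]) (by simp [Name.table, Table.coeff])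

theorem not_sqThin_E12 : ¬ SqThin k (Name.Alg (k := k) .E12) :=
  not_sqThin_of_bas (i := n1) (p := n2) (q := n3) (l := n4) (m := n5) rfl
    (by simp [Name.table, Table.coeff]) (by simp [Name.table, Table.coeff])

theorem sqThinAnn_E7 (h2 : (2 : k) ≠ 0) : SqThinAnn k (Name.Alg (k := k) .E7) := by
  intro x hx ht
  replace hx := eq_zero_iff.1 hx
  have h12 := ht.det (Name.e _ n1) (Name.e _ n2) n4 n5
  have h13 := ht.det (Name.e _ n1) (Name.e _ n3) n4 n5
  have h23 := ht.det (Name.e _ n2) (Name.e _ n3) n4 n5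
  simp only [mul_apply_rows] at hx h12 h13 h23
  simp [Name.table, rowMul, Name.e_apply] at hx h12 h13 h23
  obtain ⟨e1, e2⟩ := hx
  have e1 : x n1 * (x n2 + x n3) = 0 := mul_left_cancel₀ h2 (by linear_combination e1)
  have e2 : x n2 * (x n3 - x n1) = 0 := mul_left_cancel₀ h2 (by linear_combination e2)
  have hx1 : x n1 = 0 := by
    by_contra h
    have f1 := (mul_eq_zero.1 e1).resolve_left h
    have f2 : x n2 = x n3 - x n1 := mul_left_cancel₀ h (by linear_combination h23)
    have f3 : x n2 = 0 := by rw [← f2] at e2; exact mul_self_eq_zero.1 e2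
    have f4 : x n3 = 0 := by linear_combination f1 - f3
    exact h (by linear_combination f2 - f3 + f4)
  simp [hx1] at e2 h12 h13
  have hx2 : x n2 = 0 := by
    rcases e2 with h | h
    · exact h
    · simpa [h] using h13
  have hx3 : x n3 = 0 := by simpa [hx2] using h12
  refine mem_ann.2 fun y => eq_zero_iff.2 ?_
  simp [mul_apply_rows, Name.table, rowMul, hx1, hx2, hx3]

theorem not_sqThinAnn_E9 : ¬ SqThinAnn k (Name.Alg (k := k) .E9) :=
  not_sqThinAnn_of_bas (i := n3) (j := n1) n5 (by simp [Name.table, Table.coeff])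
    (by intro j m; cases m <;> simp [Name.table, Table.coeff]) (by simp [Name.table, Table.coeff])

theorem not_sqThinAnn_E11 : ¬ SqThinAnn k (Name.Alg (k := k) .E11) :=
  not_sqThinAnn_of_bas (i := n2) (j := n3) n4 (by simp [Name.table, Table.coeff])
    (by intro j m; cases m <;> simp [Name.table, Table.coeff]) (by simp [Name.table, Table.coeff])

theorem not_sqThinAnn_E12 : ¬ SqThinAnn k (Name.Alg (k := k) .E12) :=
  not_sqThinAnn_of_bas (i := n2) (j := n1) n4 (by simp [Name.table, Table.coeff])
    (by intro j m; cases m <;> simp [Name.table, Table.coeff]) (by simp [Name.table, Table.coeff])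

theorem thin_E11 {x : Name.Alg (k := k) .E11} (h : Thin k x) : x n1 = 0 ∧ x n3 = 0 := by
  have h12 := h.det (Name.e _ n2) (Name.e _ n1) n4 n5
  have h13 := h.det (Name.e _ n1) (Name.e _ n3) n4 n5
  simp only [mul_apply_rows] at h12 h13
  simp [Name.table, rowMul, Name.e_apply] at h12 h13
  simpa [h12] using h13

theorem thinSq_E11 : ThinSq k (Name.Alg (k := k) .E11) := by
  intro x h
  have := thin_E11 h
  simp [eq_zero_iff, mul_apply_rows, Name.table, rowMul, this.1, this.2]

theorem thinSq_E12 : ThinSq k (Name.Alg (k := k) .E12) := by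
  intro x h
  have h1 := h.det (Name.e _ n2) (Name.e _ n3) n4 n5
  simp only [mul_apply_rows] at h1
  simp [Name.table, rowMul, Name.e_apply] at h1
  simp [eq_zero_iff, mul_apply_rows, Name.table, rowMul, h1]

theorem thinSq_E20 : ThinSq k (Name.Alg (k := k) .E20) := by
  intro x h
  have h1 := h.det (Name.e _ n1) (Name.e _ n3) n2 n4
  simp only [mul_apply_rows] at h1
  simp [Name.table, rowMul, Name.e_apply] at h1
  simp [eq_zero_iff, mul_apply_rows, Name.table, rowMul, h1]

theorem not_thinSq_E9 (h2 : (2 : k) ≠ 0) : ¬ ThinSq k (Name.Alg (k := k) .E9) := by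
  intro H
  have h := eq_zero_iff.1 (H (Name.e _ n1 + Name.e _ n2) (thin_of_line (m := Name.e _ n4)
    (fun y => y n1 + y n2) fun y => alg_ext (forall_gen.2 (by
      simp [mul_apply_rows, Name.table, rowMul, Name.e_apply, add_comm]))))
  simp [mul_apply_rows, Name.table, rowMul, Name.e_apply] at h
  exact h2 (by linear_combination h)

theorem not_thinSq_E17 : ¬ ThinSq k (Name.Alg (k := k) .E17) := fun H =>
  bas_mul_bas_ne (l := n5) (by simp [Name.table, Table.coeff]) (H (Name.e _ n3) (bas_thin n5
    (by intro j m; cases m <;> simp [Name.table, Table.coeff])))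

theorem thinLine_E11 : ThinLine k (Name.Alg (k := k) .E11) := by
  intro x y hx hy
  have h1 := thin_E11 hx
  have h2 := thin_E11 hy
  have key : ∀ z : Name.Alg (k := k) .E11, z n1 = 0 → z n2 = 0 → z n3 = 0 →
      z ∈ Fm.ann.eval k (Name.Alg (k := k) .E11) := fun z hz1 hz2 hz3 => mem_ann.2 fun y =>
    eq_zero_iff.2 (by simp [mul_apply_rows, Name.table, rowMul, hz1, hz2, hz3])
  by_cases h : x n2 = 0
  · exact ⟨1, 0, by simp, key _ (by simp [h1]) (by simp [h]) (by simp [h1])⟩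
  · exact ⟨y n2, -x n2, Or.inr (neg_ne_zero.2 h), key _ (by simp [h1, h2])
      (by simp only [add_coord, smul_coord]; ring) (by simp [h1, h2])⟩

theorem not_thinLine_E12 : ¬ ThinLine k (Name.Alg (k := k) .E12) := by
  intro H
  obtain ⟨s, t, h0, h⟩ := H (Name.e _ n2) (Name.e _ n3)
    (bas_thin n4 (by intro j m; cases m <;> simp [Name.table, Table.coeff]))
    (bas_thin n5 (by intro j m; cases m <;> simp [Name.table, Table.coeff]))
  have := eq_zero_iff.1 (mem_ann.1 h (Name.e _ n1))
  simp [mul_apply_rows, Name.table, rowMul, Name.e_apply] at this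
  simp [this] at h0

/-! ### Algebras with three-dimensional square and two-dimensional cube -/

theorem sqIn_J33 : SqIn k (Name.Alg (k := k) .J33) .top .bot .sq := by
  intro x _ hx
  replace hx := eq_zero_iff.1 hx
  simp [mul_apply_rows, Name.table, rowMul] at hx
  rw [mem_sq [n1, n3] (by intro l; cases l <;> rfl)]
  obtain ⟨h1, -, h2⟩ := hx
  simpa [h1] using h2

theorem sqIn_J40 (h2 : (2 : k) ≠ 0) : SqIn k (Name.Alg (k := k) .J40) .top .bot .sq := by
  intro x _ hx
  replace hx := eq_zero_iff.1 hx
  simp [mul_apply_rows, Name.table, rowMul] at hx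
  rw [mem_sq [n1, n2] (by intro l; cases l <;> rfl)]
  obtain ⟨e1, e2, e3⟩ := hx
  have e1 : x n1 * x n2 = 0 := mul_left_cancel₀ h2 (by linear_combination e1)
  rcases mul_eq_zero.1 e1 with h | h <;> simp_all

theorem not_sqIn_J31 : ¬ SqIn k (Name.Alg (k := k) .J31) .top .bot .sq :=
  not_sqIn_of_bas (i := n3) (by simp [Name.table, Table.coeff]) (bas_notMem_sq rfl)

theorem not_sqIn_J32 : ¬ SqIn k (Name.Alg (k := k) .J32) .top .bot .sq :=
  not_sqIn_of_bas (i := n3) (by simp [Name.table, Table.coeff]) (bas_notMem_sq rfl)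

theorem not_sqIn_J36 : ¬ SqIn k (Name.Alg (k := k) .J36) .top .bot .sq :=
  not_sqIn_of_bas (i := n1) (by simp [Name.table, Table.coeff]) (bas_notMem_sq rfl)

theorem not_sqIn_J38 : ¬ SqIn k (Name.Alg (k := k) .J38) .top .bot .sq :=
  not_sqIn_of_bas (i := n2) (by simp [Name.table, Table.coeff]) (bas_notMem_sq rfl)

theorem sqMul_cube_J31 : SqMul k (Name.Alg (k := k) .J31) .cube := by
  intro x y _ _ hx hy
  rw [mem_cube [n1, n2, n3] (by intro l; cases l <;> rfl)] at hx hy ⊢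
  simp [mul_apply_rows, Name.table, rowMul] at hx hy
  simp [mul_apply_rows, Name.table, rowMul, hx, hy]

theorem sqMul_cube_J32 : SqMul k (Name.Alg (k := k) .J32) .cube := by
  intro x y _ _ hx hy
  rw [mem_cube [n1, n2, n3] (by intro l; cases l <;> rfl)] at hx hy ⊢
  simp [mul_apply_rows, Name.table, rowMul] at hx hy
  simp [mul_apply_rows, Name.table, rowMul, hx, hy]

theorem sqMul_cube_J33 : SqMul k (Name.Alg (k := k) .J33) .cube := by
  intro x y _ _ hx hy
  rw [mem_cube [n1, n2, n3] (by intro l; cases l <;> rfl)] at hx hy ⊢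
  simp [mul_apply_rows, Name.table, rowMul] at hx hy
  simp [mul_apply_rows, Name.table, rowMul, hx, hy]

theorem not_sqMul_cube {a : Name k} {i j l : Gen} (hi : a.toRat.powers.1 i = false)
    (hj : a.toRat.powers.1 j = false) (hl : a.toRat.powers.2.1 l = false)
    (h : ∀ l, a.toRat.powers.2.1 l = false → a.table.coeff i i l = 0)
    (h' : ∀ l, a.toRat.powers.2.1 l = false → a.table.coeff j j l = 0)
    (hn : a.table.coeff i j l ≠ 0) : ¬ SqMul k a.Alg .cube := by
  intro H
  have := H _ _ (bas_notMem_sq hi) (bas_notMem_sq hj)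
  simp only [a.eval_powers.2.1, mem_coord, bas_mul_bas] at this
  exact hn (this h h' l hl)

theorem not_sqMul_cube_J36 : ¬ SqMul k (Name.Alg (k := k) .J36) .cube :=
  not_sqMul_cube (i := n1) (j := n2) (l := n3) rfl rfl rfl
    (fun l _ => by simp [Name.table, Table.coeff]) (fun l _ => by simp [Name.table, Table.coeff])
    (by simp [Name.table, Table.coeff])

theorem not_sqMul_cube_J38 : ¬ SqMul k (Name.Alg (k := k) .J38) .cube :=
  not_sqMul_cube (i := n1) (j := n2) (l := n3) rfl rfl rfl
    (by
      intro l hl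
      cases l <;> first
        | simp [Name.table, Table.coeff]; done
        | exact absurd (show true = false from hl) (by decide))
    (fun l _ => by simp [Name.table, Table.coeff])
    (by simp [Name.table, Table.coeff])

theorem not_sqMul_cube_J40 : ¬ SqMul k (Name.Alg (k := k) .J40) .cube :=
  not_sqMul_cube (i := n1) (j := n2) (l := n3) rfl rfl rfl
    (by
      intro l hl
      cases l <;> first
        | simp [Name.table, Table.coeff]; done
        | exact absurd (show true = false from hl) (by decide))
    (by
      intro l hl
      cases l <;> first
        | simp [Name.table, Table.coeff]; done
        | exact absurd (show true = false from hl) (by decide))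
    (by simp [Name.table, Table.coeff])

theorem sqThin_J31 (h2 : (2 : k) ≠ 0) : SqThin k (Name.Alg (k := k) .J31) := by
  intro x h hx
  replace hx := eq_zero_iff.1 hx
  rw [mem_sq [n1, n3] (by intro l; cases l <;> rfl)] at h
  simp [mul_apply_rows, Name.table, rowMul] at hx
  obtain ⟨e1, e2, -⟩ := hx
  simp [e1] at h
  have e3 : x n2 = 0 := (mul_eq_zero.1 (show x n2 * x n3 = 0 from
    mul_left_cancel₀ h2 (by linear_combination e2))).resolve_right h
  refine thin_of_line (m := Name.e _ n4) (fun y => x n3 * y n2) fun y => alg_ext (forall_gen.2 ?_)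
  simp [mul_apply_rows, Name.table, rowMul, Name.e_apply, e1, e3]

theorem not_sqThin_J32 : ¬ SqThin k (Name.Alg (k := k) .J32) :=
  not_sqThin_of_bas (i := n3) (p := n1) (q := n2) (l := n5) (m := n4) rfl
    (by simp [Name.table, Table.coeff]) (by simp [Name.table, Table.coeff])

theorem sqMul_J38 (h2 : (2 : k) ≠ 0) : SqMul k (Name.Alg (k := k) .J38) .bot := by
  have key : ∀ x : Name.Alg (k := k) .J38, x ∉ Fm.sq.eval k (Name.Alg (k := k) .J38) →
      x * x = 0 → x n1 = 0 ∧ x n3 = 0 := by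
    intro x h hx
    replace hx := eq_zero_iff.1 hx
    rw [mem_sq [n1, n2] (by intro l; cases l <;> rfl)] at h
    simp [mul_apply_rows, Name.table, rowMul] at hx
    obtain ⟨e1, -, e3⟩ := hx
    have e1 : x n1 * x n2 = 0 := mul_left_cancel₀ h2 (by linear_combination e1)
    rcases mul_eq_zero.1 e1 with h' | h'
    · simp [h'] at h e3
      exact ⟨h', (mul_eq_zero.1 (show x n2 * x n3 = 0 from
        mul_left_cancel₀ h2 (by linear_combination e3))).resolve_left h⟩
    · simp [h'] at h e3
      exact absurd e3 h
  intro x y hx hy h1 h2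
  have hx := key x hx (mem_bot.1 h1)
  have hy := key y hy (mem_bot.1 h2)
  refine mem_bot.2 (eq_zero_iff.2 ?_)
  simp [mul_apply_rows, Name.table, rowMul, hx, hy]

theorem not_sqMul_J36 : ¬ SqMul k (Name.Alg (k := k) .J36) .bot :=
  not_sqMul_of_bas (i := n1) (j := n2) (l := n3) rfl rfl (by simp [Name.table, Table.coeff])
    (by simp [Name.table, Table.coeff]) (by simp [Name.table, Table.coeff])

/-! ### Algebras with one-dimensional fourth power -/

theorem annInSq_E2 : AnnInSq k (Name.Alg (k := k) .E2) := by
  intro x hx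
  rw [mem_ann] at hx
  have h1 := eq_zero_iff.1 (hx (Name.e _ n1))
  have h5 := eq_zero_iff.1 (hx (Name.e _ n5))
  simp [mul_apply_rows, Name.table, rowMul, Name.e_apply] at h1 h5
  rw [mem_sq [n1, n5] (by intro l; cases l <;> rfl)]
  simp [h1, h5]

theorem not_annInSq_E5 : ¬ AnnInSq k (Name.Alg (k := k) .E5) := fun H =>
  bas_notMem_sq (a := Name.E5) (i := n5) rfl (H (mem_ann.2 fun y => alg_ext fun l => by
    rw [bas_mul]; simp [Name.table, Table.coeff]))

theorem sqIn_J22 : SqIn k (Name.Alg (k := k) .J22) .top .fourth .sq := by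
  intro x _ hx
  rw [mem_fourth [n1, n2, n3, n4] (by intro l; cases l <;> rfl)] at hx
  rw [mem_sq [n1, n3] (by intro l; cases l <;> rfl)]
  simp [mul_apply_rows, Name.table, rowMul] at hx
  obtain ⟨h1, h2⟩ := hx
  simpa [h1] using h2

theorem not_sqIn_J15 (α : k) : ¬ SqIn k (Name.J15 α).Alg .top .fourth .sq := by
  intro H
  refine bas_notMem_sq (a := Name.J15 α) (i := n4) rfl (H _ trivial ?_)
  rw [mem_fourth [n1, n2, n3, n4] (by intro l; cases l <;> rfl)]
  simp only [bas_mul_bas]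
  simp [Name.table, Table.coeff]

theorem J15_eq {α β : k} (h : Isomorphic k (Name.J15 α).Alg (Name.J15 β).Alg) : α = β := by
  obtain ⟨f, hf⟩ := h
  obtain ⟨e, he⟩ : ∃ e, e = (Name.J15 α).e := ⟨_, rfl⟩
  have hm : ∀ i j l, (e i * e j) l = (Name.J15 α).table.coeff i j l := he ▸ Name.e_mul_e _
  have ha : ∀ i j, e i j = if i = j then 1 else 0 := he ▸ Name.e_apply _
  have e1 : e n1 * e n4 = 0 := alg_ext fun l => by rw [hm]; simp [Name.table, Table.coeff]
  have e2 : e n1 * e n1 = e n2 := alg_ext fun l => by rw [hm]; simp [Name.table, Table.coeff, ha]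
  have e3 : e n2 * e n4 = e n5 := alg_ext fun l => by rw [hm]; simp [Name.table, Table.coeff, ha]
  have e4 : e n2 * e n2 = e n5 := alg_ext fun l => by rw [hm]; simp [Name.table, Table.coeff, ha]
  have e5 : e n4 * e n4 = α • e n5 := alg_ext fun l => by
    rw [hm]; simp [Name.table, Table.coeff, ha]
  have e6 : f (e n5) ≠ 0 := by
    rw [Ne, EmbeddingLike.map_eq_zero_iff]
    intro h
    simpa [ha] using congrFun h n5
  obtain ⟨u, hu⟩ : ∃ u, u = f (e n1) := ⟨_, rfl⟩
  obtain ⟨v, hv⟩ : ∃ v, v = f (e n4) := ⟨_, rfl⟩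
  have g1 : u * v = 0 := by rw [hu, hv, ← hf, e1, map_zero]
  have g2 : u * u = f (e n2) := by rw [hu, ← hf, e2]
  have g3 : (u * u) * v = f (e n5) := by rw [g2, hv, ← hf, e3]
  have g4 : (u * u) * (u * u) = f (e n5) := by rw [g2, ← hf, e4]
  have g5 : v * v = α • ((u * u) * (u * u)) := by rw [hv, ← hf, e5, map_smul, g4]
  rw [← g4] at e6 g3
  have hu1 : u n1 ≠ 0 := by
    intro h
    refine e6 (eq_zero_iff.2 ?_)
    simp [mul_apply_rows, Name.table, rowMul, h]
  rw [eq_zero_iff] at g1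
  replace g3 := congrFun g3 n5
  replace g5 := congrFun g5 n5
  simp only [smul_coord] at g5
  simp [mul_apply_rows, Name.table, rowMul] at g1 g3 g5
  obtain ⟨a1, a2, -⟩ := g1
  have hv1 := a1.resolve_left hu1
  simp [hv1, hu1] at a2
  simp [hv1, a2] at g3 g5
  rw [g3.resolve_right hu1] at g5
  exact mul_right_cancel₀ (mul_ne_zero (mul_ne_zero hu1 hu1) (mul_ne_zero hu1 hu1)) g5.symm

/-! ### Algebras with one-dimensional cube and two-dimensional square -/

theorem sqIn_J9 (h2 : (2 : k) ≠ 0) : SqIn k (Name.Alg (k := k) .J9) .annSq .bot .sq := by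
  intro x h hx
  replace hx := eq_zero_iff.1 hx
  have h4 := mem_bot.1 (h (Name.e _ n3) (by
    rw [mem_sq [n1, n2, n4] (by intro l; cases l <;> rfl)]; simp [Name.e_apply]))
  replace h4 := eq_zero_iff.1 h4
  simp [mul_apply_rows, Name.table, rowMul, Name.e_apply] at h4
  simp [mul_apply_rows, Name.table, rowMul, h4] at hx
  rw [mem_sq [n1, n2, n4] (by intro l; cases l <;> rfl)]
  obtain ⟨e1, e3⟩ := hx
  have e1 : x n1 * x n2 = 0 := mul_left_cancel₀ h2 (by linear_combination e1)
  rcases mul_eq_zero.1 e1 with h | h <;> simp_all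

theorem sqIn_J21 (h2 : (2 : k) ≠ 0) : SqIn k (Name.Alg (k := k) .J21) .annSq .bot .sq := by
  intro x h hx
  replace hx := eq_zero_iff.1 hx
  have h4 := mem_bot.1 (h (Name.e _ n4) (by
    rw [mem_sq [n1, n2, n3] (by intro l; cases l <;> rfl)]; simp [Name.e_apply]))
  replace h4 := eq_zero_iff.1 h4
  simp [mul_apply_rows, Name.table, rowMul, Name.e_apply] at h4
  simp [mul_apply_rows, Name.table, rowMul, h4] at hx
  rw [mem_sq [n1, n2, n3] (by intro l; cases l <;> rfl)]
  obtain ⟨e1, e3⟩ := hx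
  have e1 : x n1 * x n2 = 0 := mul_left_cancel₀ h2 (by linear_combination e1)
  rcases mul_eq_zero.1 e1 with h | h <;> simp_all

theorem not_sqIn_J8 : ¬ SqIn k (Name.Alg (k := k) .J8) .annSq .bot .sq := fun H =>
  bas_notMem_sq (a := Name.J8) (i := n2) rfl (H _ (fun y hy => by
    rw [mem_sq [n1, n2, n4] (by intro l; cases l <;> rfl)] at hy
    simp at hy
    refine mem_bot.2 (alg_ext fun l => ?_)
    rw [bas_mul]
    simp [Name.table, Table.coeff, sum_gen, hy])
    (mem_bot.2 (bas_mul_self_eq_zero (by simp [Name.table, Table.coeff]))))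

theorem not_sqIn_J20 : ¬ SqIn k (Name.Alg (k := k) .J20) .annSq .bot .sq := fun H =>
  bas_notMem_sq (a := Name.J20) (i := n2) rfl (H _ (fun y hy => by
    rw [mem_sq [n1, n2, n3] (by intro l; cases l <;> rfl)] at hy
    simp at hy
    refine mem_bot.2 (alg_ext fun l => ?_)
    rw [bas_mul]
    simp [Name.table, Table.coeff, sum_gen, hy])
    (mem_bot.2 (bas_mul_self_eq_zero (by simp [Name.table, Table.coeff]))))

end

/-! ### The classification -/

theorem Name.cases_sig_two [IsAlgClosed k] (h2 : (2 : k) ≠ 0) {a : Name k}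
    (h : a.sig = (2, 0, 0)) :
    (SqIn k a.Alg .top .bot .ann ∧ SqMul k a.Alg .bot ∧ a = .E19) ∨
    (¬ SqIn k a.Alg .top .bot .ann ∧ SqMul k a.Alg .bot ∧ ThinSq k a.Alg ∧ a = .E20) ∨
    (¬ SqIn k a.Alg .top .bot .ann ∧ SqMul k a.Alg .bot ∧ ¬ ThinSq k a.Alg ∧ a = .E17) ∨
    (¬ SqMul k a.Alg .bot ∧ SqThin k a.Alg ∧ a = .E15) ∨
    (¬ SqMul k a.Alg .bot ∧ ¬ SqThin k a.Alg ∧ SqThinAnn k a.Alg ∧ a = .E7) ∨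
    (¬ SqMul k a.Alg .bot ∧ ¬ SqThin k a.Alg ∧ ¬ SqThinAnn k a.Alg ∧ ¬ ThinSq k a.Alg ∧
      a = .E9) ∨
    (¬ SqMul k a.Alg .bot ∧ ¬ SqThin k a.Alg ∧ ¬ SqThinAnn k a.Alg ∧ ThinSq k a.Alg ∧
      ThinLine k a.Alg ∧ a = .E11) ∨
    (¬ SqMul k a.Alg .bot ∧ ¬ SqThin k a.Alg ∧ ¬ SqThinAnn k a.Alg ∧ ThinSq k a.Alg ∧
      ¬ ThinLine k a.Alg ∧ a = .E12) := by
  cases a <;> try (simp [Name.sig] at h; done)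
  case E7 => simp [not_sqMul_E7, not_sqThin_E7, sqThinAnn_E7 h2]
  case E9 => simp [not_sqMul_E9, not_sqThin_E9, not_sqThinAnn_E9, not_thinSq_E9 h2]
  case E11 => simp [not_sqMul_E11, not_sqThin_E11, not_sqThinAnn_E11, thinSq_E11, thinLine_E11]
  case E12 => simp [not_sqMul_E12, not_sqThin_E12, not_sqThinAnn_E12, thinSq_E12, not_thinLine_E12]
  case E15 => simp [not_sqMul_E15 h2, sqThin_E15]
  case E17 => simp [not_sqIn_E17, sqMul_E17, not_thinSq_E17]
  case E19 => simp [sqIn_E19, sqMul_of_sqIn sqIn_E19]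
  case E20 => simp [not_sqIn_E20, sqMul_E20, thinSq_E20]

theorem eq_of_sig_two [IsAlgClosed k] (h2 : (2 : k) ≠ 0) {a b : Name k} (h : a.sig = (2, 0, 0))
    (hi : Isomorphic k a.Alg b.Alg) : a = b := by
  have ha := Name.cases_sig_two h2 h
  have hb := Name.cases_sig_two h2 (Name.sig_eq hi ▸ h)
  rw [iff_iff_eq.1 ⟨SqIn.of_iso hi, SqIn.of_iso hi.symm⟩,
    iff_iff_eq.1 ⟨SqMul.of_iso hi, SqMul.of_iso hi.symm⟩,
    iff_iff_eq.1 ⟨SqThin.of_iso hi, SqThin.of_iso hi.symm⟩,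
    iff_iff_eq.1 ⟨SqThinAnn.of_iso hi, SqThinAnn.of_iso hi.symm⟩,
    iff_iff_eq.1 ⟨ThinSq.of_iso hi, ThinSq.of_iso hi.symm⟩,
    iff_iff_eq.1 ⟨ThinLine.of_iso hi, ThinLine.of_iso hi.symm⟩] at ha
  clear hi h h2
  grind

theorem Name.cases_sig_three_two (h2 : (2 : k) ≠ 0) {a : Name k} (h : a.sig = (3, 2, 0)) :
    (SqIn k a.Alg .top .bot .sq ∧ SqMul k a.Alg .cube ∧ a = .J33) ∨
    (SqIn k a.Alg .top .bot .sq ∧ ¬ SqMul k a.Alg .cube ∧ a = .J40) ∨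
    (¬ SqIn k a.Alg .top .bot .sq ∧ SqMul k a.Alg .cube ∧ SqThin k a.Alg ∧ a = .J31) ∨
    (¬ SqIn k a.Alg .top .bot .sq ∧ SqMul k a.Alg .cube ∧ ¬ SqThin k a.Alg ∧ a = .J32) ∨
    (¬ SqIn k a.Alg .top .bot .sq ∧ ¬ SqMul k a.Alg .cube ∧ SqMul k a.Alg .bot ∧ a = .J38) ∨
    (¬ SqIn k a.Alg .top .bot .sq ∧ ¬ SqMul k a.Alg .cube ∧ ¬ SqMul k a.Alg .bot ∧
      a = .J36) := by
  cases a <;> try (simp [Name.sig] at h; done)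
  case J31 => simp [not_sqIn_J31, sqMul_cube_J31, sqThin_J31 h2]
  case J32 => simp [not_sqIn_J32, sqMul_cube_J32, not_sqThin_J32]
  case J33 => simp [sqIn_J33, sqMul_cube_J33]
  case J36 => simp [not_sqIn_J36, not_sqMul_cube_J36, not_sqMul_J36]
  case J38 => simp [not_sqIn_J38, not_sqMul_cube_J38, sqMul_J38 h2]
  case J40 => simp [sqIn_J40 h2, not_sqMul_cube_J40]

theorem eq_of_sig_three_two (h2 : (2 : k) ≠ 0) {a b : Name k} (h : a.sig = (3, 2, 0))
    (hi : Isomorphic k a.Alg b.Alg) : a = b := by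
  have ha := Name.cases_sig_three_two h2 h
  have hb := Name.cases_sig_three_two h2 (Name.sig_eq hi ▸ h)
  rw [iff_iff_eq.1 ⟨SqIn.of_iso hi, SqIn.of_iso hi.symm⟩,
    iff_iff_eq.1 ⟨SqMul.of_iso (φ := .cube) hi, SqMul.of_iso hi.symm⟩,
    iff_iff_eq.1 ⟨SqMul.of_iso (φ := .bot) hi, SqMul.of_iso hi.symm⟩,
    iff_iff_eq.1 ⟨SqThin.of_iso hi, SqThin.of_iso hi.symm⟩] at ha
  clear hi h h2
  grind

theorem Name.cases_sig_three_two_one (h3 : (3 : k) ≠ 0) {a : Name k} (h : a.sig = (3, 2, 1)) :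
    (IsAssociative a.Alg ∧ AnnInSq k a.Alg ∧ a = .E2) ∨
    (IsAssociative a.Alg ∧ ¬ AnnInSq k a.Alg ∧ a = .E5) ∨
    (¬ IsAssociative a.Alg ∧ SqIn k a.Alg .top .fourth .sq ∧ a = .J22) ∨
    (¬ IsAssociative a.Alg ∧ ¬ SqIn k a.Alg .top .fourth .sq ∧ ∃ α, a = .J15 α) := by
  rw [Name.isAssociative_iff h3]
  cases a <;> try (simp [Name.sig] at h; done)
  case E2 => simp [Name.IsE, annInSq_E2]
  case E5 => simp [Name.IsE, not_annInSq_E5]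
  case J15 α => simp [Name.IsE, not_sqIn_J15]
  case J22 => simp [Name.IsE, sqIn_J22]

theorem eq_of_sig_three_two_one (h3 : (3 : k) ≠ 0) {a b : Name k} (h : a.sig = (3, 2, 1))
    (hi : Isomorphic k a.Alg b.Alg) : a = b := by
  have ha := Name.cases_sig_three_two_one h3 h
  have hb := Name.cases_sig_three_two_one h3 (Name.sig_eq hi ▸ h)
  rw [iff_iff_eq.1 ⟨SqIn.of_iso hi, SqIn.of_iso hi.symm⟩,
    iff_iff_eq.1 ⟨AnnInSq.of_iso hi, AnnInSq.of_iso hi.symm⟩,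
    iff_iff_eq.1 ⟨IsAssociative.of_iso hi, IsAssociative.of_iso hi.symm⟩] at ha
  by_cases hJ : (∃ α, a = .J15 α) ∧ ∃ β, b = .J15 β
  · obtain ⟨⟨α, rfl⟩, β, rfl⟩ := hJ
    rw [J15_eq hi]
  · clear hi h h3
    grind

theorem eq_of_isMono (h2 : (2 : k) ≠ 0) {a b : Name k} (h : a.IsMono)
    (hi : Isomorphic k a.Alg b.Alg) : a = b := by
  have hb : b.IsMono := by rwa [Name.IsMono, ← Name.sig_eq hi]
  rcases eq_of_inv_eq h hb (Name.inv_eq h2 h hb hi) with h' | ⟨rfl, rfl⟩ | ⟨rfl, rfl⟩ |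
    ⟨rfl, rfl⟩ | ⟨rfl, rfl⟩
  · exact h'
  · exact absurd (SqIn.of_iso hi.symm (sqIn_J9 h2)) not_sqIn_J8
  · exact absurd (SqIn.of_iso hi (sqIn_J9 h2)) not_sqIn_J8
  · exact absurd (SqIn.of_iso hi.symm (sqIn_J21 h2)) not_sqIn_J20
  · exact absurd (SqIn.of_iso hi (sqIn_J21 h2)) not_sqIn_J20

theorem Name.eq_of_sig_zero {a : Name k} (h : a.sig = (0, 0, 0)) : a = .E25 := by
  cases a <;> simp [Name.sig] at h ⊢

theorem Name.eq_of_sig_three_zero {a : Name k} (h : a.sig = (3, 0, 0)) : a = .E16 := by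
  cases a <;> simp [Name.sig] at h ⊢

theorem Name.eq_of_sig_four {a : Name k} (h : a.sig = (4, 3, 2)) : a = .E1 := by
  cases a <;> simp [Name.sig] at h ⊢

theorem Name.sig_cases (a : Name k) :
    a.sig = (0, 0, 0) ∨ a.sig = (2, 0, 0) ∨ a.sig = (3, 0, 0) ∨ a.sig = (3, 1, 0) ∨
      a.sig = (3, 2, 0) ∨ a.sig = (3, 2, 1) ∨ a.sig = (4, 3, 2) ∨ a.IsMono := by
  cases a <;> simp [Name.sig, Name.IsMono]

theorem match_of_isomorphic [IsAlgClosed k] (h2 : (2 : k) ≠ 0) (h3 : (3 : k) ≠ 0) {a b : Name k}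
    (hi : Isomorphic k a.Alg b.Alg) : Match a b := by
  have hs := Name.sig_eq hi
  rcases a.sig_cases with h | h | h | h | h | h | h | h
  · exact Or.inl ((Name.eq_of_sig_zero h).trans (Name.eq_of_sig_zero (hs ▸ h)).symm)
  · exact Or.inl (eq_of_sig_two h2 h hi)
  · exact Or.inl ((Name.eq_of_sig_three_zero h).trans (Name.eq_of_sig_three_zero (hs ▸ h)).symm)
  · exact match_of_sig h2 h hi
  · exact Or.inl (eq_of_sig_three_two h2 h hi)
  · exact Or.inl (eq_of_sig_three_two_one h3 h hi)
  · exact Or.inl ((Name.eq_of_sig_four h).trans (Name.eq_of_sig_four (hs ▸ h)).symm)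
  · exact Or.inl (eq_of_isMono h2 h hi)

theorem Match.isomorphic [IsAlgClosed k] (h2 : (2 : k) ≠ 0) {a b : Name k} (h : Match a b) :
    Isomorphic k a.Alg b.Alg := by
  rcases h with rfl | h | h
  · exact Isomorphic.refl _
  · exact isomorphic_of_coincide h2 h
  · exact (isomorphic_of_coincide h2 h).symm

end NilJordan

theorem mainTheorem2 {k : Type*} [Field k] [IsAlgClosed k]
    (h2 : (2 : k) ≠ 0) (h3 : (3 : k) ≠ 0) :
    (∀ a : NilJordan.Name k, IsCommJordan a.Alg ∧ NilJordan.IsNilpotentAlg k a.Alg) ∧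
    (∀ a : NilJordan.Name k, NilJordan.IsAssociative a.Alg ↔ (a.IsE ∨ a = .J24 1)) ∧
    (∀ a b : NilJordan.Name k, NilJordan.Isomorphic k a.Alg b.Alg ↔
      (a = b ∨ NilJordan.Coincide a b ∨ NilJordan.Coincide b a)) :=
  ⟨fun a => ⟨a.isCommJordan, a.isNilpotentAlg⟩, fun a => a.isAssociative_iff h3,
    fun _ _ => ⟨NilJordan.match_of_isomorphic h2 h3, NilJordan.Match.isomorphic h2⟩⟩
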